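/- **Setting.** A crossed module is a group homomorphism $\partial\colon H\to G$ with a left action of $G$ on $H$ by automorphisms, $(\alpha,x)\mapsto\alpha(x)$, such that $\partial(\alpha(x))=\alpha\,\partial(x)\,\alpha^{-1}$ and $\partial(x)(y)=xyx^{-1}$. For a discrete group $\Gamma$, a $1$-cocycle with values in $\mathcal G=(H\to G)$ is a pair of maps $\alpha\colon\Gamma\to G$, $u\colon\Gamma\times\Gamma\to H$ with $\alpha_g\alpha_h=\partial(u_{g,h})\alpha_{gh}$ and $\alpha_g(u_{h,k})u_{g,hk}=u_{g,h}u_{gh,k}$. Cocycles $(\alpha^0,u^0)$ and $(\alpha^1,u^1)$ are cohomologous if there are $\gamma\in G$ and $w\colon\Gamma\to H$ with $\alpha^1_g=\partial(w_g)\gamma\alpha^0_g\gamma^{-1}$ and $u^1_{g,h}=w_g\,\gamma\big(\alpha^0_g(\gamma^{-1}(w_h))u^0_{g,h}\big)w_{gh}^{-1}$; $H^1(\Gamma,\mathcal G)$ is the set of classes, pointed by the class of the trivial cocycle. (As $\Gamma$ is discrete, topologies on $H$ and $G$ play no role.) A short exact sequence of crossed modules $(N\to1)\to(H_0\to G)\to(H_1\to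 G)$ consists of an exact sequence of groups $1\to N\to H_0\xrightarrow{p}H_1\to1$, $N$ abelian, where $p$ is $G$-equivariant and compatible with the boundary maps to $G$. Each cocycle $(\alpha,u)$ with values in $\mathcal G_1=(H_1\to G)$ makes $N$ a $\Gamma$-module by $g\cdot n=\alpha_g(n)$. Let $\bigoplus_{\sim\mathcal G_1}H^3(\Gamma,N)$ be the set of orbits of $G$ on the direct sum of the groups $H^3(\Gamma,N)$ over all $\Gamma$-module structures on $N$ arising in this way, where $\gamma\in G$ acts by $\omega\mapsto\gamma(\omega)$ from the summand of $(\alpha,u)$ to that of $(\gamma\alpha\gamma^{-1},\gamma(u))$; it is pointed by the orbit of $0$. The sequence of pointed sets associated with the short exact sequence is $$H^2(\Gamma,N)\to H^1(\Gamma,H_0\to G)\to H^1(\Gamma,H_1\to G)\xrightarrow{\ \theta\ }\bigoplus_{\sim\mathcal G_1}H^3(\Gamma,N),$$ with trivial action of $\Gamma$ on $N$ in the first term. Its maps are $[\lambda]\mapsto[(1,\lambda)]$, the map induced by $p$, and the connecting map $\theta$, which sends $[(\alpha,u)]$ to the image of the class of $$\omega_{g,h,k}=\alpha_g(v_{h,k})\,v_{g,hk}\,v_{gh,k}^{-1}\,v_{g,h}^{-1},\qquad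 v_{g,h}\in H_0,\ p(v_{g,h})=u_{g,h}.$$ Here exactness at $Y$ of pointed maps $X\xrightarrow{f}Y\xrightarrow{g}(Z,z_0)$ means $g^{-1}(z_0)=f(X)$. Let $A$ be a unital C*-algebra with unitary group $U(A)$, $\mathrm{Ad}_u(a)=uau^*$, $\mathrm{Out}(A)=\mathrm{Aut}(A)/\mathrm{Ad}(U(A))$, $Z_A=Z(U(A))$ and $PU(A)=U(A)/Z_A$. Let $\tilde U(A)$ be the group, under pointwise multiplication, of continuous paths in $U(A)$ starting at $1$ modulo the null-homotopic loops at $1$; this is the universal cover of $U(A)$ when $U(A)$ is connected. Let $K_0^\#(A)\subset\tilde U(A)$ be the classes of paths ending in $Z_A$ and $\pi_1(U(A))\subset\tilde U(A)$ the classes of loops. For a tracial state $\tau$ let $SU_\tau(A)$ be the group of finite products of $e^{ih}$ with $h=h^*\in\ker\tau$, let $Z_A^\tau=Z(SU_\tau(A))$, and let $\mathrm{Aut}_\tau(A)$ be the group of $\tau$-preserving automorphisms. Consider the crossed modules $\mathcal G_A=(U(A)\to\mathrm{Aut}(A))$, $P\mathcal G_A=(PU(A)\to\mathrm{Aut}(A))$,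 $\tilde{\mathcal G}_A=(\tilde U(A)\to\mathrm{Aut}(A))$, $S\mathcal G_A^\tau=(SU_\tau(A)\to\mathrm{Aut}_\tau(A))$ and $P\mathcal G_A^\tau=(PU(A)\to\mathrm{Aut}_\tau(A))$, with boundary maps induced by $\mathrm{Ad}$ (composed with evaluation at the end point for $\tilde U(A)$) and the canonical actions. **Theorem.** Let $\Gamma$ be a discrete group and $A$ a unital C*-algebra. The following sequences of pointed sets, associated with the evident short exact sequences of crossed modules, are well defined and exact at their two middle terms: 1. $H^2(\Gamma,Z_A)\to H^1(\Gamma,\mathcal G_A)\to H^1(\Gamma,P\mathcal G_A)\xrightarrow{\mathrm{ob}}\bigoplus_{\sim P\mathcal G_A}H^3(\Gamma,Z_A)$; and, if $U(A)$ is connected, 2. $H^2(\Gamma,K_0^\#(A))\to H^1(\Gamma,\tilde{\mathcal G}_A)\to H^1(\Gamma,P\mathcal G_A)\xrightarrow{\widetilde{\mathrm{ob}}}\bigoplus_{\sim P\mathcal G_A}H^3(\Gamma,K_0^\#(A))$; 3. $H^2(\Gamma,\pi_1(U(A)))\to H^1(\Gamma,\tilde{\mathcal G}_A)\to H^1(\Gamma,\mathcal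 G_A)\xrightarrow{\kappa^3}\bigoplus_{\sim\mathcal G_A}H^3(\Gamma,\pi_1(U(A)))$; 4. for every tracial state $\tau$ of $A$, $H^2(\Gamma,Z_A^\tau)\to H^1(\Gamma,S\mathcal G_A^\tau)\to H^1(\Gamma,P\mathcal G_A^\tau)\xrightarrow{\mathrm{ob}_\tau}\bigoplus_{\sim P\mathcal G_A^\tau}H^3(\Gamma,Z_A^\tau)$. The maps $\mathrm{ob}$, $\widetilde{\mathrm{ob}}$ and $\mathrm{ob}_\tau$ are the lifting obstructions of $\Gamma$-kernels. That is, let $\kappa\colon\Gamma\to\mathrm{Out}(A)$ be a homomorphism, let $\alpha_g\in\mathrm{Aut}(A)$ (resp. $\mathrm{Aut}_\tau(A)$ for $\mathrm{ob}_\tau$) be lifts of $\kappa_g$, and let $v_{g,h}$ in $U(A)$ (resp. $\tilde U(A)$, $SU_\tau(A)$) satisfy $\alpha_g\alpha_h=\partial(v_{g,h})\alpha_{gh}$. Then $\alpha$ together with the image of $v$ in $PU(A)$ is a $1$-cocycle, and its class is mapped to the image of the class of $\alpha_g(v_{h,k})v_{g,hk}v_{gh,k}^{-1}v_{g,h}^{-1}$.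 Likewise $\kappa^3$ sends a cocycle action $(\alpha,u)$ to the image of the class obtained from lifts $v_{g,h}\in\tilde U(A)$ of $u_{g,h}$. **Naturality.** The sequences are natural in $\Gamma$ and in the coefficients. More precisely, let $f\colon\Gamma'\to\Gamma$ be a group homomorphism and $\Phi$ a morphism from one short exact sequence of crossed modules as above to another, the latter with terms $N',H_0',H_1',G'$, and suppose that both have connecting maps $\theta,\theta'$ (over $\Gamma$ and $\Gamma'$ respectively). Then the two left-hand squares formed by $(f,\Phi)$ commute. Moreover, if $x\in H^3(\Gamma,N)$ is the class of $\omega$ for a cocycle $c$ and a lift $v$ of its second component, then the induced class of $x$ is the one for the image of $c$ and the image of $v$, and $\theta'$ sends the image of $[c]$ to the element given by this class. Finally, suppose that the module structure on $N'$ induced by the image of a cocycle depends only on the module structure on $N$ induced by the cocycle (as is always the case when $\Phi$ is the identity). Then the maps between the individual groups $H^3$ define a homomorphism of the direct sums, which descends to the orbit sets, and the right-hand square commutes. -/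

import Mathlib

universe u v

noncomputable section

/-! ### Group cohomology in degrees two and three

Coefficients are a multiplicatively written abelian group `M` on which a discrete group `Γ` acts
through `ρ : Γ →* MulAut M`.  The inhomogeneous cochain complex is written out in the degrees that
are needed, so that the ground ring, the group and the coefficients may live in different
universes. -/

namespace GrpCoh

variable {Γ : Type*} [Group Γ] {M : Type*} [CommGroup M]

/-- The inhomogeneous differential from `1`-cochains to `2`-cochains. -/
def d1 (ρ : Γ →* MulAut M) : (Γ → M) →* (Γ → Γ → M) where
  toFun η g h := ρ g (η h) * (η (g * h))⁻¹ * η g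
  map_one' := by
    funext g h
    simp
  map_mul' η η' := by
    funext g h
    simp only [Pi.mul_apply, map_mul, mul_inv]
    simp only [mul_assoc, mul_left_comm, mul_comm]

/-- The inhomogeneous differential from `2`-cochains to `3`-cochains. -/
def d2 (ρ : Γ →* MulAut M) : (Γ → Γ → M) →* (Γ → Γ → Γ → M) where
  toFun η g h k := ρ g (η h k) * (η (g * h) k)⁻¹ * η g (h * k) * (η g h)⁻¹
  map_one' := by
    funext g h k
    simp
  map_mul' η η' := by
    funext g h k
    simp only [Pi.mul_apply, map_mul, mul_inv]
    simp only [mul_assoc, mul_left_comm, mul_comm]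

/-- The inhomogeneous differential from `3`-cochains to `4`-cochains. -/
def d3 (ρ : Γ →* MulAut M) : (Γ → Γ → Γ → M) →* (Γ → Γ → Γ → Γ → M) where
  toFun ω g h k l :=
    ρ g (ω h k l) * (ω (g * h) k l)⁻¹ * ω g (h * k) l * (ω g h (k * l))⁻¹ * ω g h k
  map_one' := by
    funext g h k l
    simp
  map_mul' η η' := by
    funext g h k l
    simp only [Pi.mul_apply, map_mul, mul_inv]
    simp only [mul_assoc, mul_left_comm, mul_comm]

/-- `2`-cocycles. -/
abbrev Z2 (ρ : Γ →* MulAut M) : Subgroup (Γ → Γ → M) := (d2 ρ).ker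

/-- `3`-cocycles. -/
abbrev Z3 (ρ : Γ →* MulAut M) : Subgroup (Γ → Γ → Γ → M) := (d3 ρ).ker

/-- `H²(Γ, M)`: `2`-cocycles modulo `2`-coboundaries. -/
abbrev H2 (ρ : Γ →* MulAut M) : Type _ := Z2 ρ ⧸ (d1 ρ).range.subgroupOf (Z2 ρ)

/-- `H³(Γ, M)`: `3`-cocycles modulo `3`-coboundaries. -/
abbrev H3 (ρ : Γ →* MulAut M) : Type _ := Z3 ρ ⧸ (d2 ρ).range.subgroupOf (Z3 ρ)

section Functoriality

variable {Γ' : Type*} [Group Γ'] {M' : Type*} [CommGroup M']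
  {ρ : Γ →* MulAut M} {ρ' : Γ' →* MulAut M'}

/-- Pull-back of `2`-cocycles along `f : Γ' → Γ` and push-forward along `χ : M → M'`. -/
def Z2map (f : Γ' →* Γ) (χ : M →* M') (hχ : ∀ g m, χ (ρ (f g) m) = ρ' g (χ m)) :
    Z2 ρ →* Z2 ρ' where
  toFun l := ⟨fun g h => χ (l.1 (f g) (f h)), by
    obtain ⟨l, hl⟩ := l
    rw [MonoidHom.mem_ker] at hl ⊢
    funext g h k
    have := congrArg χ (congrFun (congrFun (congrFun hl (f g)) (f h)) (f k))
    simpa [d2, hχ] using this⟩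
  map_one' := by
    ext
    simp
  map_mul' a b := by
    ext
    simp

/-- Pull-back of `3`-cocycles along `f : Γ' → Γ` and push-forward along `χ : M → M'`. -/
def Z3map (f : Γ' →* Γ) (χ : M →* M') (hχ : ∀ g m, χ (ρ (f g) m) = ρ' g (χ m)) :
    Z3 ρ →* Z3 ρ' where
  toFun l := ⟨fun g h k => χ (l.1 (f g) (f h) (f k)), by
    obtain ⟨l, hl⟩ := l
    rw [MonoidHom.mem_ker] at hl ⊢
    funext g h k m
    have := congrArg χ (congrFun (congrFun (congrFun (congrFun hl (f g)) (f h)) (f k)) (f m))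
    simpa [d3, hχ] using this⟩
  map_one' := by
    ext
    simp
  map_mul' a b := by
    ext
    simp

/-- The map `H²(Γ, M) → H²(Γ', M')` induced by `f : Γ' → Γ` and an equivariant `χ : M → M'`. -/
def H2map (f : Γ' →* Γ) (χ : M →* M') (hχ : ∀ g m, χ (ρ (f g) m) = ρ' g (χ m)) :
    H2 ρ →* H2 ρ' :=
  QuotientGroup.map _ _ (Z2map f χ hχ) (by
    rintro ⟨l, hl⟩ ⟨η, hη⟩
    refine ⟨fun g => χ (η (f g)), ?_⟩
    funext g h
    have := congrArg χ (congrFun (congrFun hη (f g)) (f h))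
    simpa [d1, Z2map, hχ] using this)

/-- The map `H³(Γ, M) → H³(Γ', M')` induced by `f : Γ' → Γ` and an equivariant `χ : M → M'`. -/
def H3map (f : Γ' →* Γ) (χ : M →* M') (hχ : ∀ g m, χ (ρ (f g) m) = ρ' g (χ m)) :
    H3 ρ →* H3 ρ' :=
  QuotientGroup.map _ _ (Z3map f χ hχ) (by
    rintro ⟨l, hl⟩ ⟨η, hη⟩
    refine ⟨fun g h => χ (η (f g) (f h)), ?_⟩
    funext g h k
    have := congrArg χ (congrFun (congrFun (congrFun hη (f g)) (f h)) (f k))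
    simpa [d2, Z3map, hχ] using this)

end Functoriality

end GrpCoh

/-! ### Crossed modules and their first cohomology -/

/-- A crossed module `bd : H → G`.  Only the underlying groups are recorded: for a discrete group
`Γ` the set `H¹(Γ, -)` does not depend on topologies on `H` and `G`. -/
structure CrossedModule (H G : Type*) [Group H] [Group G] where
  /-- the boundary homomorphism -/
  bd : H →* G
  /-- the left action of `G` on `H` by automorphisms -/
  act : G →* MulAut H
  bd_act : ∀ a x, bd (act a x) = a * bd x * a⁻¹
  act_bd : ∀ x y, act (bd x) y = x * y * x⁻¹

namespace CrossedModule

section Cohomology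

variable {H G : Type*} [Group H] [Group G] (X : CrossedModule H G)

/-- `1`-cocycles on `Γ` with values in a crossed module. -/
@[ext]
structure Cocycle (Γ : Type*) [Group Γ] where
  α : Γ → G
  u : Γ → Γ → H
  α_mul : ∀ g h, α g * α h = X.bd (u g h) * α (g * h)
  u_mul : ∀ g h k, X.act (α g) (u h k) * u g (h * k) = u g h * u (g * h) k

variable {X} {Γ : Type*} [Group Γ]

/-- Two `1`-cocycles are cohomologous. -/
def Cohomologous (c d : X.Cocycle Γ) : Prop :=
  ∃ (γ : G) (w : Γ → H),
    (∀ g, d.α g = X.bd (w g) * γ * c.α g * γ⁻¹) ∧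
    (∀ g h, d.u g h =
      w g * X.act γ (X.act (c.α g) (X.act γ⁻¹ (w h)) * c.u g h) * (w (g * h))⁻¹)

variable (X Γ) in
/-- The trivial cocycle. -/
def Cocycle.triv : X.Cocycle Γ where
  α _ := 1
  u _ _ := 1
  α_mul := by simp
  u_mul := by simp

variable (X Γ) in
/-- `H¹(Γ, X)`: `1`-cocycles up to being cohomologous, pointed by the trivial cocycle. -/
def H1 : Type _ := Quot (Cohomologous (X := X) (Γ := Γ))

/-- The class of a cocycle. -/
def H1.mk (c : X.Cocycle Γ) : X.H1 Γ := Quot.mk _ c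

variable (X Γ) in
/-- The base point of `H¹(Γ, X)`. -/
def H1.base : X.H1 Γ := H1.mk (Cocycle.triv X Γ)

/-- Conjugation of a cocycle by an element of `G`. -/
def Cocycle.conj (γ : G) (c : X.Cocycle Γ) : X.Cocycle Γ where
  α g := γ * c.α g * γ⁻¹
  u g h := X.act γ (c.u g h)
  α_mul g h := by
    rw [X.bd_act]
    have := c.α_mul g h
    calc γ * c.α g * γ⁻¹ * (γ * c.α h * γ⁻¹) = γ * (c.α g * c.α h) * γ⁻¹ := by group
      _ = _ := by rw [this]; group
  u_mul g h k := by
    have := congrArg (X.act γ) (c.u_mul g h k)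
    simpa [map_mul, MulAut.mul_apply] using this

end Cohomology

/-- Morphisms of crossed modules. -/
structure Hom {H G H' G' : Type*} [Group H] [Group G] [Group H'] [Group G']
    (X : CrossedModule H G) (X' : CrossedModule H' G') where
  top : H →* H'
  base : G →* G'
  bd_top : ∀ x, X'.bd (top x) = base (X.bd x)
  top_act : ∀ a x, top (X.act a x) = X'.act (base a) (top x)

section Functoriality

variable {H G H' G' : Type*} [Group H] [Group G] [Group H'] [Group G']
  {X : CrossedModule H G} {X' : CrossedModule H' G'} {Γ Γ' : Type*} [Group Γ] [Group Γ']

/-- Pull-back of a cocycle along `f : Γ' → Γ` and push-forward along `X → X'`. -/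
def Cocycle.map (Φ : Hom X X') (f : Γ' →* Γ) (c : X.Cocycle Γ) : X'.Cocycle Γ' where
  α g := Φ.base (c.α (f g))
  u g h := Φ.top (c.u (f g) (f h))
  α_mul g h := by
    rw [Φ.bd_top, ← map_mul, c.α_mul, map_mul, map_mul]
  u_mul g h k := by
    rw [← Φ.top_act, ← map_mul, map_mul f, c.u_mul, map_mul Φ.top, map_mul f]

/-- The induced map `H¹(Γ, X) → H¹(Γ', X')`. -/
def H1.map (Φ : Hom X X') (f : Γ' →* Γ) : X.H1 Γ → X'.H1 Γ' :=
  Quot.map (Cocycle.map Φ f) (by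
    rintro c d ⟨γ, w, h1, h2⟩
    refine ⟨Φ.base γ, fun g => Φ.top (w (f g)), fun g => ?_, fun g h => ?_⟩
    · simp [Cocycle.map, h1, Φ.bd_top]
    · have := Φ.top_act γ⁻¹ (w (f h))
      rw [map_inv] at this
      simp only [Cocycle.map, h2, map_mul, map_inv, Φ.top_act] at this ⊢
      rw [this])

end Functoriality

/-! ### Short exact sequences `(N → 1) → (H₀ → G) → (H₁ → G)` -/

/-- A short exact sequence of crossed modules
`(N → 1) ⟶ (H₀ → G) ⟶ (H₁ → G)` with `N` abelian and the identity on `G`. -/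
structure Extension (N H₀ H₁ G : Type*) [CommGroup N] [Group H₀] [Group H₁] [Group G] where
  X₀ : CrossedModule H₀ G
  X₁ : CrossedModule H₁ G
  i : N →* H₀
  p : H₀ →* H₁
  i_injective : Function.Injective i
  p_surjective : Function.Surjective p
  range_i : i.range = p.ker
  bd_p : ∀ x, X₁.bd (p x) = X₀.bd x
  p_act : ∀ a x, p (X₀.act a x) = X₁.act a (p x)

/-- Restriction of an action by automorphisms to an invariant subgroup. -/
def restrictAct {H G : Type*} [Group H] [Group G] (ρ : G →* MulAut H) (K : Subgroup H)
    (hK : ∀ a, ∀ k ∈ K, ρ a k ∈ K) : G →* MulAut K where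
  toFun a :=
    { toFun := fun k => ⟨ρ a k, hK a k k.2⟩
      invFun := fun k => ⟨ρ a⁻¹ k, hK a⁻¹ k k.2⟩
      left_inv := fun k => by
        ext
        simp
      right_inv := fun k => by
        ext
        simp
      map_mul' := fun k l => by
        ext
        simp }
  map_one' := by
    ext
    simp
  map_mul' a b := by
    ext
    simp

/-- The action induced on the quotient by an invariant normal subgroup. -/
def quotientAct {H G : Type*} [Group H] [Group G] (ρ : G →* MulAut H) (K : Subgroup H) [K.Normal]
    (hK : ∀ a, ∀ k ∈ K, ρ a k ∈ K) : G →* MulAut (H ⧸ K) where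
  toFun a :=
    MonoidHom.toMulEquiv (QuotientGroup.map K K (ρ a).toMonoidHom (hK a))
      (QuotientGroup.map K K (ρ a⁻¹).toMonoidHom (hK a⁻¹))
      (by
        ext x
        simp)
      (by
        ext x
        simp)
  map_one' := by
    ext x
    induction x using QuotientGroup.induction_on with
    | H x => simp
  map_mul' a b := by
    ext x
    induction x using QuotientGroup.induction_on with
    | H x => simp

namespace Extension

section Basic

variable {N H₀ H₁ G : Type*} [CommGroup N] [Group H₀] [Group H₁] [Group G]
  (E : Extension N H₀ H₁ G)

/-- The morphism `(H₀ → G) ⟶ (H₁ → G)`. -/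
def proj : Hom E.X₀ E.X₁ where
  top := E.p
  base := MonoidHom.id G
  bd_top := E.bd_p
  top_act := E.p_act

lemma p_i (n : N) : E.p (E.i n) = 1 := by
  have : E.i n ∈ E.p.ker := E.range_i ▸ ⟨n, rfl⟩
  exact this

lemma bd_i (n : N) : E.X₀.bd (E.i n) = 1 := by
  rw [← E.bd_p, E.p_i, map_one]

lemma i_central (n : N) (x : H₀) : E.i n * x = x * E.i n := by
  have h := E.X₀.act_bd (E.i n) x
  rw [E.bd_i, map_one, MulAut.one_apply] at h
  rw [eq_comm, mul_inv_eq_iff_eq_mul] at h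
  exact h

/-- The action of `G` on `N` that is the restriction of the action on `H₀`
(see `Extension.i_actN`). -/
def actN : G →* MulAut N :=
  (MulAut.congr (MonoidHom.ofInjective E.i_injective).symm).toMonoidHom.comp
    (restrictAct E.X₀.act E.i.range (by
      intro a k hk
      rw [E.range_i, MonoidHom.mem_ker] at hk ⊢
      rw [E.p_act, hk, map_one]))

lemma i_actN (a : G) (n : N) : E.i (E.actN a n) = E.X₀.act a (E.i n) := by
  have h := MonoidHom.apply_ofInjective_symm E.i_injective
  have h' : ((MonoidHom.ofInjective E.i_injective n : E.i.range) : H₀) = E.i n := rfl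
  simp [actN, h, h', restrictAct]

lemma actN_bd (y : H₁) : E.actN (E.X₁.bd y) = 1 := by
  obtain ⟨x, rfl⟩ := E.p_surjective y
  ext n
  apply E.i_injective
  rw [E.i_actN, E.bd_p, E.X₀.act_bd, ← E.i_central]
  simp

variable {Γ : Type*} [Group Γ]

/-- The `Γ`-module structure on `N` induced by a cocycle `(α, u)`: `g • n = α_g(n)`. -/
def actΓ (c : E.X₁.Cocycle Γ) : Γ →* MulAut N :=
  MonoidHom.mk' (fun g => E.actN (c.α g)) (fun g h => by
    rw [← map_mul, c.α_mul, map_mul, E.actN_bd, one_mul])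

/-- The `1`-cocycle `(1, l)` with values in `H₀ → G` given by a `2`-cocycle `l` with values in `N`
(with trivial action of `Γ`). -/
def cocycleOfZ2 (l : GrpCoh.Z2 (1 : Γ →* MulAut N)) : E.X₀.Cocycle Γ where
  α _ := 1
  u g h := E.i (l.1 g h)
  α_mul g h := by rw [E.bd_i, mul_one]
  u_mul g h k := by
    have hl : l.1 h k * (l.1 (g * h) k)⁻¹ * l.1 g (h * k) * (l.1 g h)⁻¹ = 1 :=
      congrFun (congrFun (congrFun l.2 g) h) k
    rw [map_one, MulAut.one_apply, ← map_mul, ← map_mul]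
    congr 1
    rw [mul_inv_eq_one, mul_right_comm, mul_inv_eq_iff_eq_mul] at hl
    exact hl

variable (Γ) in
/-- The map `H²(Γ, N) → H¹(Γ, H₀ → G)`, `[l] ↦ [(1, l)]`. -/
def fromH2 : GrpCoh.H2 (1 : Γ →* MulAut N) → E.X₀.H1 Γ :=
  Quotient.lift (fun l => H1.mk (E.cocycleOfZ2 l)) (by
    intro a b hab
    obtain ⟨η, hη⟩ := QuotientGroup.leftRel_apply.mp hab
    refine Quot.sound ⟨1, fun g => E.i (η g), fun g => ?_, fun g h => ?_⟩
    · simp [cocycleOfZ2, E.bd_i]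
    · have h1 : η h * (η (g * h))⁻¹ * η g = (a.1 g h)⁻¹ * b.1 g h :=
        congrFun (congrFun hη g) h
      have h2 : b.1 g h = η g * (η h * a.1 g h) * (η (g * h))⁻¹ := by
        rw [← mul_inv_cancel_left (a.1 g h) (b.1 g h), ← h1]
        simp only [mul_assoc, mul_left_comm, mul_comm]
      simp [cocycleOfZ2, h2])

/-! ### The last term -/

variable (Γ) in
/-- The `Γ`-module structures on `N` that are induced by cocycles with values in `H₁ → G`. -/
def ModStr : Type _ := {a : Γ →* MulAut N // ∃ c : E.X₁.Cocycle Γ, a = E.actΓ c}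

/-- The module structure induced by a cocycle. -/
def modStr (c : E.X₁.Cocycle Γ) : E.ModStr Γ := ⟨E.actΓ c, c, rfl⟩

instance : DecidableEq (E.ModStr Γ) := Classical.decEq _

/-- `γ ∈ G` sends the module structure of `(α, u)` to that of `(γ α γ⁻¹, γ(u))`. -/
def conjModStr (γ : G) (a : E.ModStr Γ) : E.ModStr Γ :=
  ⟨(MulAut.conj (E.actN γ)).toMonoidHom.comp a.1, by
    obtain ⟨a, c, rfl⟩ := a
    refine ⟨c.conj γ, ?_⟩
    ext g n
    simp [actΓ, Cocycle.conj, MulAut.conj_apply]⟩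

variable (Γ) in
/-- The direct sum of the groups `H³(Γ, N)` over all module structures on `N` that are induced by
cocycles with values in `H₁ → G`. -/
abbrev H3Sum : Type _ := DirectSum (E.ModStr Γ) (fun a => Additive (GrpCoh.H3 a.1))

/-- The map `ω ↦ γ(ω)` from one summand to another. -/
def conjH3 (γ : G) (a : E.ModStr Γ) : GrpCoh.H3 a.1 →* GrpCoh.H3 (E.conjModStr γ a).1 :=
  GrpCoh.H3map (MonoidHom.id Γ) (E.actN γ).toMonoidHom (fun g m => by
    simp [conjModStr, MulAut.conj_apply])

variable (Γ) in
/-- The action of `γ ∈ G` on the direct sum. -/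
def sumAct (γ : G) : E.H3Sum Γ →+ E.H3Sum Γ :=
  DirectSum.toAddMonoid fun a =>
    (DirectSum.of (fun a : E.ModStr Γ => Additive (GrpCoh.H3 a.1)) (E.conjModStr γ a)).comp
      (MonoidHom.toAdditive (E.conjH3 γ a))

variable (Γ) in
/-- The last term of the exact sequence: the set of orbits of `G` in the direct sum. -/
def Obs : Type _ := Quot (fun x y : E.H3Sum Γ => ∃ γ : G, y = E.sumAct Γ γ x)

/-- The orbit of an element of the direct sum. -/
def Obs.mk (x : E.H3Sum Γ) : E.Obs Γ := Quot.mk _ x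

variable (Γ) in
/-- The base point: the orbit of zero. -/
def Obs.base : E.Obs Γ := Obs.mk E 0

/-- The element of the direct sum given by a class in the summand of the cocycle `c`. -/
def toSum (c : E.X₁.Cocycle Γ) (x : GrpCoh.H3 (E.actΓ c)) : E.H3Sum Γ :=
  DirectSum.of (fun a : E.ModStr Γ => Additive (GrpCoh.H3 a.1)) (E.modStr c) (Additive.ofMul x)

/-- The canonical map from `H³(Γ, N)`, with the module structure given by `c`, to the last term. -/
def ι (c : E.X₁.Cocycle Γ) (x : GrpCoh.H3 (E.actΓ c)) : E.Obs Γ := Obs.mk E (E.toSum c x)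

/-- `ω_{g,h,k} = α_g(v_{h,k}) v_{g,hk} v_{gh,k}⁻¹ v_{g,h}⁻¹`, an identity in `H₀`. -/
def IsObsCochain (α : Γ → G) (v : Γ → Γ → H₀) (ω : Γ → Γ → Γ → N) : Prop :=
  ∀ g h k, E.i (ω g h k) =
    E.X₀.act (α g) (v h k) * v g (h * k) * (v (g * h) k)⁻¹ * (v g h)⁻¹

/-- `x` is the class in `H³(Γ, N)` of the `3`-cocycle that is computed from the lift `v` of the
second component of the cocycle `c`. -/
def IsObsClass (c : E.X₁.Cocycle Γ) (v : Γ → Γ → H₀) (x : GrpCoh.H3 (E.actΓ c)) : Prop :=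
  ∃ ω : GrpCoh.Z3 (E.actΓ c), E.IsObsCochain c.α v ω.1 ∧ x = QuotientGroup.mk ω

/-- `θ` is the connecting map: whenever `v` lifts `u`, the class of `(α, u)` is sent to the image
of the class of `α_g(v_{h,k}) v_{g,hk} v_{gh,k}⁻¹ v_{g,h}⁻¹`.  As lifts exist, there is at most one
such `θ`. -/
def IsConnecting (θ : E.X₁.H1 Γ → E.Obs Γ) : Prop :=
  ∀ (c : E.X₁.Cocycle Γ) (v : Γ → Γ → H₀), (∀ g h, E.p (v g h) = c.u g h) →
    ∃ x, E.IsObsClass c v x ∧ θ (H1.mk c) = E.ι c x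

/-- Exactness of the pointed maps `S → T → U` at `T`. -/
def PointedExact {S T U : Type*} (f : S → T) (g : T → U) (z : U) : Prop :=
  ∀ y, g y = z ↔ ∃ x, f x = y

/-- `H²(Γ, N) → H¹(Γ, H₀ → G) → H¹(Γ, H₁ → G) → ⨁ H³(Γ, N)` is an exact sequence of pointed
sets, where the last map `θ` is the connecting map. -/
structure IsExactSequence (θ : E.X₁.H1 Γ → E.Obs Γ) : Prop where
  connecting : E.IsConnecting θ
  fromH2_base : E.fromH2 Γ 1 = H1.base E.X₀ Γ
  proj_base : H1.map E.proj (MonoidHom.id Γ) (H1.base E.X₀ Γ) = H1.base E.X₁ Γ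
  θ_base : θ (H1.base E.X₁ Γ) = Obs.base E Γ
  exact₀ : PointedExact (E.fromH2 Γ) (H1.map E.proj (MonoidHom.id Γ)) (H1.base E.X₁ Γ)
  exact₁ : PointedExact (H1.map E.proj (MonoidHom.id Γ)) θ (Obs.base E Γ)

/-- `θ` is given by the lifting obstruction of `Γ`-kernels, i.e. of homomorphisms `κ : Γ → Q` to
the quotient `q : G → Q`: whenever `α_g` lifts `κ_g` and `α_g α_h = ∂(v_{g,h}) α_{gh}`, the pair of
`α` and the image of `v` is a cocycle whose class is sent by `θ` to the class of
`α_g(v_{h,k}) v_{g,hk} v_{gh,k}⁻¹ v_{g,h}⁻¹`. -/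
def IsKernelObstruction {Q : Type*} [Group Q] (q : G →* Q) (θ : E.X₁.H1 Γ → E.Obs Γ) : Prop :=
  ∀ (κ : Γ →* Q) (α : Γ → G) (v : Γ → Γ → H₀), (∀ g, q (α g) = κ g) →
    (∀ g h, α g * α h = E.X₀.bd (v g h) * α (g * h)) →
    ∃ c : E.X₁.Cocycle Γ, c.α = α ∧ (∀ g h, c.u g h = E.p (v g h)) ∧
      ∃ x, E.IsObsClass c v x ∧ θ (H1.mk c) = E.ι c x

end Basic

/-! ### Naturality -/

/-- Morphisms of short exact sequences of crossed modules. -/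
structure Hom {N H₀ H₁ G N' H₀' H₁' G' : Type*} [CommGroup N] [Group H₀] [Group H₁] [Group G]
    [CommGroup N'] [Group H₀'] [Group H₁'] [Group G']
    (E : Extension N H₀ H₁ G) (E' : Extension N' H₀' H₁' G') where
  fN : N →* N'
  f₀ : CrossedModule.Hom E.X₀ E'.X₀
  f₁ : CrossedModule.Hom E.X₁ E'.X₁
  base_eq : f₀.base = f₁.base
  comm_i : ∀ n, E'.i (fN n) = f₀.top (E.i n)
  comm_p : ∀ x, E'.p (f₀.top x) = f₁.top (E.p x)

section Naturality

variable {N H₀ H₁ G N' H₀' H₁' G' : Type*} [CommGroup N] [Group H₀] [Group H₁] [Group G]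
  [CommGroup N'] [Group H₀'] [Group H₁'] [Group G']
  {E : Extension N H₀ H₁ G} {E' : Extension N' H₀' H₁' G'}
  {Γ Γ' : Type*} [Group Γ] [Group Γ']

variable (E) in
/-- The identity morphism. -/
def Hom.id : Hom E E where
  fN := MonoidHom.id N
  f₀ := ⟨MonoidHom.id H₀, MonoidHom.id G, fun _ => rfl, fun _ _ => rfl⟩
  f₁ := ⟨MonoidHom.id H₁, MonoidHom.id G, fun _ => rfl, fun _ _ => rfl⟩
  base_eq := rfl
  comm_i _ := rfl
  comm_p _ := rfl

lemma Hom.fN_actN (Φ : Hom E E') (a : G) (n : N) :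
    Φ.fN (E.actN a n) = E'.actN (Φ.f₁.base a) (Φ.fN n) := by
  apply E'.i_injective
  rw [Φ.comm_i, E.i_actN, E'.i_actN, Φ.comm_i, Φ.f₀.top_act, Φ.base_eq]

/-- The induced map `H²(Γ, N) → H²(Γ', N')`. -/
def Hom.H2map (Φ : Hom E E') (f : Γ' →* Γ) :
    GrpCoh.H2 (1 : Γ →* MulAut N) →* GrpCoh.H2 (1 : Γ' →* MulAut N') :=
  GrpCoh.H2map f Φ.fN (fun _ _ => rfl)

/-- The induced map `H³(Γ, N) → H³(Γ', N')`, where the module structures are those given by a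
cocycle `c` and by its image. -/
def Hom.H3map (Φ : Hom E E') (f : Γ' →* Γ) (c : E.X₁.Cocycle Γ) :
    GrpCoh.H3 (E.actΓ c) →* GrpCoh.H3 (E'.actΓ (c.map Φ.f₁ f)) :=
  GrpCoh.H3map f Φ.fN (fun g n => Φ.fN_actN (c.α (f g)) n)

/-- The two left-hand squares commute, and `θ'` sends the image of a class `[c]` to the image of
the obstruction class of `c`. -/
structure NaturalSquares (Φ : Hom E E') (f : Γ' →* Γ) (θ' : E'.X₁.H1 Γ' → E'.Obs Γ') :
    Prop where
  square₀ : ∀ x, E'.fromH2 Γ' (Φ.H2map f x) = H1.map Φ.f₀ f (E.fromH2 Γ x)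
  square₁ : ∀ y, H1.map E'.proj (MonoidHom.id Γ') (H1.map Φ.f₀ f y) =
    H1.map Φ.f₁ f (H1.map E.proj (MonoidHom.id Γ) y)
  class₂ : ∀ (c : E.X₁.Cocycle Γ) (v : Γ → Γ → H₀) (x : GrpCoh.H3 (E.actΓ c)),
    (∀ g h, E.p (v g h) = c.u g h) → E.IsObsClass c v x →
      E'.IsObsClass (c.map Φ.f₁ f) (fun g h => Φ.f₀.top (v (f g) (f h))) (Φ.H3map f c x) ∧
      θ' (H1.map Φ.f₁ f (H1.mk c)) = E'.ι (c.map Φ.f₁ f) (Φ.H3map f c x)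

/-- The induced maps between the summands `H³(Γ, N)` and `H³(Γ', N')` define a homomorphism of the
direct sums, which descends to the orbit sets, and the right-hand square commutes. -/
def NaturalLastSquare (Φ : Hom E E') (f : Γ' →* Γ) (θ : E.X₁.H1 Γ → E.Obs Γ)
    (θ' : E'.X₁.H1 Γ' → E'.Obs Γ') : Prop :=
  ∃ (S : E.H3Sum Γ →+ E'.H3Sum Γ') (T : E.Obs Γ → E'.Obs Γ'),
    (∀ c x, S (E.toSum c x) = E'.toSum (c.map Φ.f₁ f) (Φ.H3map f c x)) ∧
    (∀ y, T (Obs.mk E y) = Obs.mk E' (S y)) ∧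
    ∀ z, T (θ z) = θ' (H1.map Φ.f₁ f z)

/-- The module structure on `N'` over `Γ'` induced by the image of a cocycle depends only on the
module structure on `N` over `Γ` induced by the cocycle. -/
def Hom.RespectsModStr (Φ : Hom E E') (f : Γ' →* Γ) : Prop :=
  ∀ c d : E.X₁.Cocycle Γ, E.actΓ c = E.actΓ d →
    E'.actΓ (c.map Φ.f₁ f) = E'.actΓ (d.map Φ.f₁ f)

end Naturality

end Extension

end CrossedModule

/-! ### Groups and crossed modules associated to a unital C*-algebra -/

namespace CStarCM

open CrossedModule

variable (A : Type u) [CStarAlgebra A]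

/-- The automorphism group of `A`. -/
abbrev AutA : Type u := A ≃⋆ₐ[ℂ] A

/-- `Ad_u(a) = u a u*`. -/
abbrev Ad : unitary A →* AutA A := Unitary.conjStarAlgAut ℂ A

/-- Automorphisms act on the unitary group. -/
def autU : AutA A →* MulAut (unitary A) where
  toFun a :=
    { toFun := fun x => ⟨a x, Unitary.map_mem a x.2⟩
      invFun := fun x => ⟨a.symm x, Unitary.map_mem a.symm x.2⟩
      left_inv := fun x => Subtype.ext (a.symm_apply_apply _)
      right_inv := fun x => Subtype.ext (a.apply_symm_apply _)
      map_mul' := fun x y => Subtype.ext (map_mul a _ _) }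
  map_one' := by
    ext x
    rfl
  map_mul' a b := by
    ext x
    rfl

variable {A} in
@[simp] lemma coe_autU (a : AutA A) (x : unitary A) : ((autU A a x : unitary A) : A) = a x := rfl

lemma Ad_autU (a : AutA A) (x : unitary A) : Ad A (autU A a x) = a * Ad A x * a⁻¹ := by
  ext b
  simp only [Unitary.conjStarAlgAut_apply, coe_autU, StarAlgEquiv.mul_apply]
  have h : a (a⁻¹ b) = b := by
    rw [← StarAlgEquiv.mul_apply, mul_inv_cancel]
    rfl
  rw [map_mul, map_mul, h, map_star]

/-- The crossed module `Ad : U(A) → Aut(A)`. -/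
def GA : CrossedModule (unitary A) (AutA A) where
  bd := Ad A
  act := autU A
  bd_act := Ad_autU A
  act_bd x y := by
    ext
    simp [← Unitary.star_eq_inv]

/-- The group of inner automorphisms. -/
def Inn : Subgroup (AutA A) := (Ad A).range

instance : (Inn A).Normal where
  conj_mem := by
    rintro _ ⟨x, rfl⟩ a
    exact ⟨autU A a x, Ad_autU A a x⟩

/-- `Out(A) = Aut(A) / Inn(A)`. -/
abbrev OutA : Type u := AutA A ⧸ Inn A

/-- The projective unitary group `PU(A) = U(A) / Z(U(A))`. -/
abbrev PU : Type u := unitary A ⧸ Subgroup.center (unitary A)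

lemma autU_center (a : AutA A) (z : unitary A) (hz : z ∈ Subgroup.center (unitary A)) :
    autU A a z ∈ Subgroup.center (unitary A) := by
  rw [Subgroup.mem_center_iff] at hz ⊢
  intro g
  obtain ⟨x, rfl⟩ := (autU A a).surjective g
  rw [← map_mul, hz, map_mul]

lemma Ad_center : Subgroup.center (unitary A) ≤ (Ad A).ker := by
  intro z hz
  rw [Subgroup.mem_center_iff] at hz
  rw [MonoidHom.mem_ker]
  have key : ∀ b : A, (z : A) * b = b * z := by
    intro b
    have hb : b ∈ Submodule.span ℂ (unitary A : Set A) := by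
      rw [CStarAlgebra.span_unitary]
      trivial
    induction hb using Submodule.span_induction with
    | mem x hx => exact (congrArg Subtype.val (hz ⟨x, hx⟩)).symm
    | zero => simp
    | add x y _ _ hx hy => rw [mul_add, add_mul, hx, hy]
    | smul c x _ hx => rw [mul_smul_comm, smul_mul_assoc, hx]
  ext b
  rw [Unitary.conjStarAlgAut_apply, key, mul_assoc]
  simp

/-- `Ad : PU(A) → Aut(A)`. -/
def AdPU : PU A →* AutA A := QuotientGroup.lift _ (Ad A) (Ad_center A)

/-- `Aut(A)` acts on `PU(A)`. -/
def autPU : AutA A →* MulAut (PU A) :=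
  quotientAct (autU A) (Subgroup.center (unitary A)) (autU_center A)

/-- The crossed module `Ad : PU(A) → Aut(A)`. -/
def PGA : CrossedModule (PU A) (AutA A) where
  bd := AdPU A
  act := autPU A
  bd_act a x := by
    induction x using QuotientGroup.induction_on with
    | H x => exact (GA A).bd_act a x
  act_bd x y := by
    induction x using QuotientGroup.induction_on with
    | H x =>
      induction y using QuotientGroup.induction_on with
      | H y => exact congrArg (QuotientGroup.mk' (Subgroup.center (unitary A))) ((GA A).act_bd x y)

instance centerCommGroup (H : Type*) [Group H] : CommGroup (Subgroup.center H) :=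
  { (inferInstance : Group (Subgroup.center H)) with
    mul_comm := fun x y => Subtype.ext (Subgroup.mem_center_iff.mp y.2 x) }

/-- The short exact sequence `Z(U(A)) → U(A) → PU(A)` over `Aut(A)`. -/
def extU : Extension (Subgroup.center (unitary A)) (unitary A) (PU A) (AutA A) where
  X₀ := GA A
  X₁ := PGA A
  i := (Subgroup.center (unitary A)).subtype
  p := QuotientGroup.mk' _
  i_injective := Subtype.val_injective
  p_surjective := QuotientGroup.mk'_surjective _
  range_i := by simp
  bd_p _ := rfl
  p_act _ _ := rfl

/-! #### The universal cover of the unitary group -/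

/-- Continuous paths in `U(A)` that start at `1`, with pointwise multiplication. -/
def PathU : Subgroup C(unitInterval, unitary A) where
  carrier := {γ | γ 0 = 1}
  one_mem' := rfl
  mul_mem' {a b} ha hb := by
    change _ = _ at ha hb ⊢
    rw [ContinuousMap.mul_apply, ha, hb, one_mul]
  inv_mem' {a} ha := by
    change _ = _ at ha ⊢
    rw [ContinuousMap.inv_apply, ha, inv_one]

/-- The loops in `U(A)` based at `1` that are homotopic, relative to the end points, to the
constant loop. -/
def NullLoops : Subgroup (PathU A) where
  carrier := {γ | ContinuousMap.HomotopicRel γ.1 1 {0, 1}}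
  one_mem' := ContinuousMap.HomotopicRel.refl _
  mul_mem' {a b} := by
    rintro ⟨F⟩ ⟨G⟩
    exact ⟨{  toFun := fun x => F x * G x
              continuous_toFun := by fun_prop
              map_zero_left := fun x => by simp
              map_one_left := fun x => by simp
              prop' := fun t x hx => by
                have h1 := F.prop' t x hx
                have h2 := G.prop' t x hx
                simp at h1 h2
                simp [h1, h2] }⟩
  inv_mem' {a} := by
    rintro ⟨F⟩
    exact ⟨{  toFun := fun x => (F x)⁻¹
              continuous_toFun := by fun_prop
              map_zero_left := fun x => by simp
              map_one_left := fun x => by simp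
              prop' := fun t x hx => by
                have h1 := F.prop' t x hx
                simp at h1
                simp [h1] }⟩

instance : (NullLoops A).Normal where
  conj_mem := by
    rintro a ⟨F⟩ b
    exact ⟨{  toFun := fun x => b.1 x.2 * F x * (b.1 x.2)⁻¹
              continuous_toFun := by fun_prop
              map_zero_left := fun x => by simp
              map_one_left := fun x => by simp
              prop' := fun t x hx => by
                have h1 := F.prop' t x hx
                simp at h1
                simp [h1] }⟩

/-- The universal cover `Ũ(A)` of `U(A)`: paths starting at `1` modulo null-homotopic loops. -/
abbrev Utilde : Type u := PathU A ⧸ NullLoops A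

/-- The end point map `q : Ũ(A) → U(A)`. -/
def endpt : Utilde A →* unitary A :=
  QuotientGroup.lift (NullLoops A)
    { toFun := fun γ => γ.1 1
      map_one' := rfl
      map_mul' := fun _ _ => rfl }
    (by
      rintro γ ⟨F⟩
      have h := F.prop' 1 1 (by simp)
      simp at h
      exact h.symm)

lemma continuous_autU (a : AutA A) : Continuous (autU A a) := by
  have h : Continuous (a : A → A) := (StarAlgEquiv.isometry a).continuous
  exact Continuous.subtype_mk (h.comp continuous_subtype_val) _

/-- `Aut(A)` acts on paths pointwise. -/
def autPath : AutA A →* MulAut (PathU A) where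
  toFun a :=
    { toFun := fun γ => ⟨⟨fun t => autU A a (γ.1 t), (continuous_autU A a).comp γ.1.continuous⟩, by
        have h : γ.1 0 = 1 := γ.2
        change autU A a (γ.1 0) = 1
        rw [h, map_one]⟩
      invFun := fun γ => ⟨⟨fun t => autU A a⁻¹ (γ.1 t),
        (continuous_autU A a⁻¹).comp γ.1.continuous⟩, by
        have h : γ.1 0 = 1 := γ.2
        change autU A a⁻¹ (γ.1 0) = 1
        rw [h, map_one]⟩
      left_inv := fun γ => by
        apply Subtype.ext
        ext1 t
        change autU A a⁻¹ (autU A a (γ.1 t)) = γ.1 t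
        rw [← MulAut.mul_apply, ← map_mul, inv_mul_cancel, map_one, MulAut.one_apply]
      right_inv := fun γ => by
        apply Subtype.ext
        ext1 t
        change autU A a (autU A a⁻¹ (γ.1 t)) = γ.1 t
        rw [← MulAut.mul_apply, ← map_mul, mul_inv_cancel, map_one, MulAut.one_apply]
      map_mul' := fun γ δ => by
        apply Subtype.ext
        ext1 t
        exact map_mul (autU A a) (γ.1 t) (δ.1 t) }
  map_one' := rfl
  map_mul' _ _ := rfl

/-- `Aut(A)` acts on `Ũ(A)`. -/
def autUtilde : AutA A →* MulAut (Utilde A) :=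
  quotientAct (autPath A) (NullLoops A) (by
    rintro a γ ⟨F⟩
    exact ⟨{  toFun := fun x => autU A a (F x)
              continuous_toFun := (continuous_autU A a).comp F.continuous
              map_zero_left := fun x => by
                rw [F.apply_zero]
                rfl
              map_one_left := fun x => by
                rw [F.apply_one]
                exact map_one _
              prop' := fun t x hx => congrArg (autU A a) (F.prop' t x hx) }⟩)

/-- The crossed module `Ũ(A) → Aut(A)`. -/
def GtildeA : CrossedModule (Utilde A) (AutA A) where
  bd := (Ad A).comp (endpt A)
  act := autUtilde A
  bd_act a x := by
    induction x using QuotientGroup.induction_on with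
    | H x => exact (GA A).bd_act a (x.1 1)
  act_bd x y := by
    induction x using QuotientGroup.induction_on with
    | H x =>
      induction y using QuotientGroup.induction_on with
      | H y =>
        have hx : x.1 0 = 1 := x.2
        have hy : y.1 0 = 1 := y.2
        have hxy : ∀ s, (autPath A (Ad A (x.1 1)) y).1 s = x.1 1 * y.1 s * (x.1 1)⁻¹ :=
          fun s => (GA A).act_bd (x.1 1) (y.1 s)
        change ((autPath A (Ad A (x.1 1)) y : PathU A) : Utilde A) =
          ((x * y * x⁻¹ : PathU A) : Utilde A)
        symm
        rw [QuotientGroup.eq]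
        refine ⟨{
          toFun := fun z => (x.1 z.2 * y.1 z.2 * (x.1 z.2)⁻¹)⁻¹ *
            (x.1 (z.2 ⊔ unitInterval.symm z.1) * y.1 z.2 *
              (x.1 (z.2 ⊔ unitInterval.symm z.1))⁻¹)
          continuous_toFun := by fun_prop
          map_zero_left := fun s => ?_
          map_one_left := fun s => ?_
          prop' := fun t s hs => ?_ }⟩
        · have h1 : s ⊔ (1 : unitInterval) = 1 := sup_eq_right.mpr unitInterval.le_one'
          simp [hxy, h1]
        · simp [mul_assoc]
        · rcases hs with rfl | hs
          · simp [hxy, hy]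
          · rw [Set.mem_singleton_iff] at hs
            subst hs
            have h1 : (1 : unitInterval) ⊔ unitInterval.symm t = 1 :=
              sup_eq_left.mpr unitInterval.le_one'
            simp [hxy, h1]

/-- `K₀^#(A)`: classes of paths from `1` to a point of `Z(U(A))`. -/
def K0sharp : Subgroup (Utilde A) := (Subgroup.center (unitary A)).comap (endpt A)

/-- `π₁(U(A))`: classes of loops based at `1`. -/
def pi1U : Subgroup (Utilde A) := (endpt A).ker

lemma K0sharp_central (x y : Utilde A) (hx : x ∈ K0sharp A) : x * y = y * x := by
  have h := (GtildeA A).act_bd x y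
  have h1 : (GtildeA A).bd x = 1 := Ad_center A hx
  rw [h1, map_one, MulAut.one_apply, eq_comm, mul_inv_eq_iff_eq_mul] at h
  exact h

instance : CommGroup (K0sharp A) :=
  { (inferInstance : Group (K0sharp A)) with
    mul_comm := fun x y => Subtype.ext (K0sharp_central A x y x.2) }

instance : CommGroup (pi1U A) :=
  { (inferInstance : Group (pi1U A)) with
    mul_comm := fun x y => Subtype.ext (K0sharp_central A x y (by
      have h : endpt A x = 1 := x.2
      change endpt A x ∈ Subgroup.center (unitary A)
      rw [h]
      exact one_mem _)) }

lemma endpt_surjective [ConnectedSpace (unitary A)] : Function.Surjective (endpt A) := by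
  have : PathConnectedSpace (unitary A) := pathConnectedSpace_iff_connectedSpace.mpr inferInstance
  intro x
  obtain ⟨γ⟩ := PathConnectedSpace.joined (1 : unitary A) x
  exact ⟨QuotientGroup.mk ⟨γ.toContinuousMap, γ.source⟩, γ.target⟩

/-- The short exact sequence `K₀^#(A) → Ũ(A) → PU(A)` over `Aut(A)`. -/
def extUtildePU [ConnectedSpace (unitary A)] :
    Extension (K0sharp A) (Utilde A) (PU A) (AutA A) where
  X₀ := GtildeA A
  X₁ := PGA A
  i := (K0sharp A).subtype
  p := (QuotientGroup.mk' _).comp (endpt A)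
  i_injective := Subtype.val_injective
  p_surjective := (QuotientGroup.mk'_surjective _).comp (endpt_surjective A)
  range_i := by
    rw [Subgroup.range_subtype, ← MonoidHom.comap_ker, QuotientGroup.ker_mk']
    rfl
  bd_p _ := rfl
  p_act a x := by
    induction x using QuotientGroup.induction_on with
    | H x => rfl

/-- The short exact sequence `π₁(U(A)) → Ũ(A) → U(A)` over `Aut(A)`. -/
def extUtildeU [ConnectedSpace (unitary A)] :
    Extension (pi1U A) (Utilde A) (unitary A) (AutA A) where
  X₀ := GtildeA A
  X₁ := GA A
  i := (pi1U A).subtype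
  p := endpt A
  i_injective := Subtype.val_injective
  p_surjective := endpt_surjective A
  range_i := Subgroup.range_subtype _
  bd_p _ := rfl
  p_act a x := by
    induction x using QuotientGroup.induction_on with
    | H x => rfl

/-! #### The special unitary group of a trace -/

variable {A}

open scoped ComplexOrder in
/-- Tracial states. -/
structure IsTracialState (τ : A →ₗ[ℂ] ℂ) : Prop where
  map_one : τ 1 = 1
  nonneg : ∀ a, 0 ≤ τ (star a * a)
  map_mul_comm : ∀ a b, τ (a * b) = τ (b * a)

/-- `SU_τ(A)`: finite products of exponentials `e^{ih}` with `h` self-adjoint and `τ(h) = 0`. -/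
def SU (τ : A →ₗ[ℂ] ℂ) : Subgroup (unitary A) where
  carrier := {x | ∃ l : List (selfAdjoint A), (∀ h ∈ l, τ (h : A) = 0) ∧
    x = (l.map selfAdjoint.expUnitary).prod}
  one_mem' := ⟨[], by simp, by simp⟩
  mul_mem' := by
    rintro _ _ ⟨l, hl, rfl⟩ ⟨m, hm, rfl⟩
    refine ⟨l ++ m, ?_, by simp⟩
    intro h hh
    rcases List.mem_append.mp hh with hh | hh
    · exact hl h hh
    · exact hm h hh
  inv_mem' := by
    rintro _ ⟨l, hl, rfl⟩
    refine ⟨(l.map (fun h => -h)).reverse, ?_, ?_⟩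
    · intro h hh
      simp only [List.mem_reverse, List.mem_map] at hh
      obtain ⟨k, hk, rfl⟩ := hh
      simp [hl k hk]
    · rw [List.prod_inv_reverse, List.map_reverse, List.map_map, List.map_map]
      congr 2
      apply List.map_congr_left
      intro h _
      rw [Function.comp_apply, Function.comp_apply, inv_eq_iff_mul_eq_one,
        ← Commute.expUnitary_add (by simp [Commute, SemiconjBy])]
      simp

/-- The automorphisms of `A` that preserve `τ`. -/
def AutTau (τ : A →ₗ[ℂ] ℂ) : Subgroup (AutA A) where
  carrier := {a | ∀ b, τ (a b) = τ b}
  one_mem' _ := rfl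
  mul_mem' {a b} ha hb x := (ha (b x)).trans (hb x)
  inv_mem' {a} ha x := by
    have h : a (a⁻¹ x) = x := by
      rw [← StarAlgEquiv.mul_apply, mul_inv_cancel]
      rfl
    rw [← ha (a⁻¹ x), h]

lemma Ad_mem_AutTau {τ : A →ₗ[ℂ] ℂ} (hτ : IsTracialState τ) (x : unitary A) :
    Ad A x ∈ AutTau τ := by
  intro b
  rw [Unitary.conjStarAlgAut_apply, hτ.map_mul_comm, ← mul_assoc]
  simp

lemma autU_expUnitary (a : AutA A) (h : selfAdjoint A) :
    autU A a (selfAdjoint.expUnitary h) =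
      selfAdjoint.expUnitary ⟨a h, IsSelfAdjoint.map h.2 a⟩ := by
  ext
  have hc : Continuous (a : A → A) := (StarAlgEquiv.isometry a).continuous
  let _ : NormedAlgebra ℚ A := .restrictScalars ℚ ℂ A
  simp only [coe_autU, selfAdjoint.expUnitary_coe]
  rw [NormedSpace.map_exp a hc, map_smul]

lemma autU_SU {τ : A →ₗ[ℂ] ℂ} (a : AutA A) (ha : a ∈ AutTau τ) (x : unitary A) (hx : x ∈ SU τ) :
    autU A a x ∈ SU τ := by
  obtain ⟨l, hl, rfl⟩ := hx
  refine ⟨l.map (fun h : selfAdjoint A => ⟨a h, IsSelfAdjoint.map h.2 a⟩), ?_, ?_⟩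
  · intro h hh
    obtain ⟨k, hk, rfl⟩ := List.mem_map.mp hh
    exact (ha _).trans (hl k hk)
  · rw [map_list_prod, List.map_map, List.map_map]
    congr 1
    apply List.map_congr_left
    intro h _
    exact autU_expUnitary a h

/-- `Aut_τ(A)` acts on `SU_τ(A)`. -/
def autSU (τ : A →ₗ[ℂ] ℂ) : AutTau τ →* MulAut (SU τ) where
  toFun a :=
    { toFun := fun x => ⟨autU A a x, autU_SU _ a.2 _ x.2⟩
      invFun := fun x => ⟨autU A (a⁻¹ : AutTau τ) x, autU_SU _ (a⁻¹ : AutTau τ).2 _ x.2⟩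
      left_inv := fun x => by
        ext1
        change autU A (a : AutA A)⁻¹ (autU A a x) = x
        rw [← MulAut.mul_apply, ← map_mul, inv_mul_cancel, map_one, MulAut.one_apply]
      right_inv := fun x => by
        ext1
        change autU A a (autU A (a : AutA A)⁻¹ x) = x
        rw [← MulAut.mul_apply, ← map_mul, mul_inv_cancel, map_one, MulAut.one_apply]
      map_mul' := fun x y => by
        ext1
        exact map_mul (autU A a) _ _ }
  map_one' := rfl
  map_mul' _ _ := rfl

/-- The crossed module `Ad : SU_τ(A) → Aut_τ(A)`. -/
def SGA {τ : A →ₗ[ℂ] ℂ} (hτ : IsTracialState τ) : CrossedModule (SU τ) (AutTau τ) where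
  bd := ((Ad A).comp (SU τ).subtype).codRestrict (AutTau τ) (fun x => Ad_mem_AutTau hτ x)
  act := autSU τ
  bd_act a x := Subtype.ext ((GA A).bd_act a x)
  act_bd x y := Subtype.ext ((GA A).act_bd x y)

/-- The crossed module `Ad : PU(A) → Aut_τ(A)`. -/
def PGAtau {τ : A →ₗ[ℂ] ℂ} (hτ : IsTracialState τ) : CrossedModule (PU A) (AutTau τ) where
  bd := (AdPU A).codRestrict (AutTau τ) (fun x => by
    induction x using QuotientGroup.induction_on with
    | H x => exact Ad_mem_AutTau hτ x)
  act := (autPU A).comp (AutTau τ).subtype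
  bd_act a x := Subtype.ext ((PGA A).bd_act a x)
  act_bd x y := (PGA A).act_bd x y

/-- The homomorphism `Aut_τ(A) → Out(A)`. -/
def outTau (τ : A →ₗ[ℂ] ℂ) : AutTau τ →* OutA A :=
  (QuotientGroup.mk' (Inn A)).comp (AutTau τ).subtype

lemma IsTracialState.im_eq_zero {τ : A →ₗ[ℂ] ℂ} (hτ : IsTracialState τ) (h : selfAdjoint A) :
    (τ (h : A)).im = 0 := by
  have hh : star (h : A) = h := h.2
  have h1 := (Complex.le_def.mp (hτ.nonneg ((h : A) + 1))).2
  have h2 := (Complex.le_def.mp (hτ.nonneg (h : A))).2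
  simp only [star_add, star_one, hh, add_mul, mul_add, mul_one, one_mul, map_add, hτ.map_one,
    Complex.add_im, Complex.zero_im, Complex.one_im] at h1 h2
  linarith

lemma exists_SU_mul_center [ConnectedSpace (unitary A)] {τ : A →ₗ[ℂ] ℂ} (hτ : IsTracialState τ)
    (x : unitary A) : ∃ y ∈ SU τ, ∃ z ∈ Subgroup.center (unitary A), x = y * z := by
  have : PathConnectedSpace (unitary A) := pathConnectedSpace_iff_connectedSpace.mpr inferInstance
  obtain ⟨l, rfl⟩ := Unitary.mem_pathComponentOne_iff.mp
    (PathConnectedSpace.joined (1 : unitary A) x)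
  induction l with
  | nil => exact ⟨1, one_mem _, 1, one_mem _, by simp⟩
  | cons h l ih =>
    obtain ⟨y, hy, z, hz, hl⟩ := ih
    set r : selfAdjoint A := (τ (h : A)).re • 1 with hr
    have hcomm : ∀ b : A, Commute (r : A) b := by
      intro b
      simp [hr, Commute, SemiconjBy]
    have hexp : selfAdjoint.expUnitary h =
        selfAdjoint.expUnitary (h - r) * selfAdjoint.expUnitary r := by
      rw [← Commute.expUnitary_add (hcomm _).symm, sub_add_cancel]
    have hτr : τ ((h - r : selfAdjoint A) : A) = 0 := by
      have h1 : ((r : selfAdjoint A) : A) = ((τ (h : A)).re : ℂ) • (1 : A) := by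
        simp [hr]
      rw [AddSubgroupClass.coe_sub, map_sub, h1, map_smul, hτ.map_one]
      apply Complex.ext <;> simp [hτ.im_eq_zero]
    have hrc : selfAdjoint.expUnitary r ∈ Subgroup.center (unitary A) := by
      rw [Subgroup.mem_center_iff]
      intro g
      let _ : NormedAlgebra ℚ A := .restrictScalars ℚ ℂ A
      ext
      exact (Commute.exp_left (((hcomm (g : A)).smul_left Complex.I))).symm
    refine ⟨selfAdjoint.expUnitary (h - r) * y, mul_mem ⟨[h - r], by simpa using hτr, by simp⟩ hy,
      selfAdjoint.expUnitary r * z, mul_mem hrc hz, ?_⟩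
    rw [List.map_cons, List.prod_cons, hl, hexp]
    have := Subgroup.mem_center_iff.mp hrc y
    rw [mul_assoc, mul_assoc, ← mul_assoc _ y z, ← this, mul_assoc]

/-- The short exact sequence `Z(SU_τ(A)) → SU_τ(A) → PU(A)` over `Aut_τ(A)`. -/
def extSU [ConnectedSpace (unitary A)] {τ : A →ₗ[ℂ] ℂ} (hτ : IsTracialState τ) :
    Extension (Subgroup.center (SU τ)) (SU τ) (PU A) (AutTau τ) where
  X₀ := SGA hτ
  X₁ := PGAtau hτ
  i := (Subgroup.center (SU τ)).subtype
  p := (QuotientGroup.mk' (Subgroup.center (unitary A))).comp (SU τ).subtype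
  i_injective := Subtype.val_injective
  p_surjective x := by
    induction x using QuotientGroup.induction_on with
    | H x =>
      obtain ⟨y, hy, z, hz, rfl⟩ := exists_SU_mul_center hτ x
      exact ⟨⟨y, hy⟩, QuotientGroup.eq.mpr (by simpa using hz)⟩
  range_i := by
    rw [Subgroup.range_subtype]
    ext x
    rw [MonoidHom.mem_ker, MonoidHom.comp_apply, QuotientGroup.mk'_apply,
      QuotientGroup.eq_one_iff, Subgroup.mem_center_iff, Subgroup.mem_center_iff]
    constructor
    · intro h g
      obtain ⟨y, hy, z, hz, rfl⟩ := exists_SU_mul_center hτ g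
      have h1 : y * (x : unitary A) = x * y := congrArg Subtype.val (h ⟨y, hy⟩)
      have h2 := Subgroup.mem_center_iff.mp hz (x : unitary A)
      change y * z * (x : unitary A) = x * (y * z)
      rw [mul_assoc, ← h2, ← mul_assoc, h1, mul_assoc]
    · intro h g
      exact Subtype.ext (h g)
  bd_p _ := rfl
  p_act _ _ := rfl

end CStarCM

end

/-! All four sequences are instances of one statement about an extension `E` of crossed modules.
Only two facts about C*-algebras enter: the sequences of groups are exact, which is part of the
construction of the extensions, and `PU(A) → Aut(A)` is injective.

Lift the second component of a cocycle `(α, u)` to `v` in `H₀`. Then `v` satisfies the cocycle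
identity up to a factor `ω` in `N`, which is central in `H₀`. Expanding a triple product in two ways
shows that `ω` is a 3-cocycle (`IsObsCochain.mem_Z3`). Replacing `v` by `η v` multiplies `ω` by the
coboundary of `η` (`IsObsCochain.mul_i`), so the class depends on the cocycle alone. Being
cohomologous means conjugating by some `γ` and then twisting by some `w`. Twisting leaves `ω` and
the module structure unchanged, and conjugation replaces `ω` by `γ(ω)`. Thus the class is well
defined in the orbit set.

Exactness at `H¹(Γ, H₁ → G)`: the orbit of zero is `{0}` and each summand embeds, so a class goes to
the base point iff `ω` is the coboundary of some `η`, in which case `η⁻¹ v` is a cocycle lifting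
`u`. Exactness at `H¹(Γ, H₀ → G)`: if the image of `(α, u)` is a twist of the trivial cocycle by
`p(w)`, then twisting `(α, u)` by `w⁻¹` gives `(1, l)` with `l` in `N`.

For kernels, injectivity of the boundary of `H₁` reduces the cocycle identity to associativity in
`G`. Naturality holds on the level of cochains; the condition on module structures serves only to
define one map on each summand. -/

noncomputable section

namespace CrossedModule

/-! ### Cohomologous cocycles as orbits of conjugations and twists -/

section Cohomology

variable {H G : Type*} [Group H] [Group G] {X : CrossedModule H G} {Γ : Type*} [Group Γ]

lemma Cocycle.act_act_α (c : X.Cocycle Γ) (g h : Γ) (x : H) :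
    X.act (c.α g) (X.act (c.α h) x) = c.u g h * X.act (c.α (g * h)) x * (c.u g h)⁻¹ := by
  rw [← MulAut.mul_apply, ← map_mul, c.α_mul, map_mul, MulAut.mul_apply, X.act_bd]

/-- The cocycle `(∂(w) α, w_g α_g(w_h) u_{g,h} w_{gh}⁻¹)`. -/
def Cocycle.twist (w : Γ → H) (c : X.Cocycle Γ) : X.Cocycle Γ where
  α g := X.bd (w g) * c.α g
  u g h := w g * X.act (c.α g) (w h) * c.u g h * (w (g * h))⁻¹
  α_mul g h := by
    simp only [map_mul, map_inv, X.bd_act]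
    have := c.α_mul g h
    rw [← eq_mul_inv_iff_mul_eq] at this
    rw [this]
    group
  u_mul g h k := by
    have h1 := c.u_mul g h k
    have h2 := c.act_act_α g h (w k)
    rw [← eq_mul_inv_iff_mul_eq] at h1
    simp only [map_mul, map_inv, MulAut.mul_apply, X.act_bd, h1, h2, mul_assoc g h k]
    group

/-- Since `γ(α_g(γ⁻¹(w_h))) = (γ α_g γ⁻¹)(w_h)`, the relation factors into a conjugation followed by
a twist. Every later invariance check splits accordingly. -/
lemma cohomologous_iff (c d : X.Cocycle Γ) :
    Cohomologous c d ↔ ∃ (γ : G) (w : Γ → H), d = (c.conj γ).twist w := by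
  constructor
  · rintro ⟨γ, w, h1, h2⟩
    refine ⟨γ, w, ?_⟩
    ext g h
    · simp [Cocycle.twist, Cocycle.conj, h1, mul_assoc]
    · simp [Cocycle.twist, Cocycle.conj, h2, mul_assoc]
  · rintro ⟨γ, w, rfl⟩
    exact ⟨γ, w, fun g => by simp [Cocycle.twist, Cocycle.conj, mul_assoc],
      fun g h => by simp [Cocycle.twist, Cocycle.conj, mul_assoc]⟩

lemma Cocycle.conj_conj (γ δ : G) (c : X.Cocycle Γ) : (c.conj γ).conj δ = c.conj (δ * γ) := by
  ext g h
  · simp [Cocycle.conj, mul_assoc]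
  · simp [Cocycle.conj]

lemma Cocycle.conj_one (c : X.Cocycle Γ) : c.conj 1 = c := by
  ext g h
  · simp [Cocycle.conj]
  · simp [Cocycle.conj]

lemma Cocycle.twist_one (c : X.Cocycle Γ) : c.twist 1 = c := by
  ext g h
  · simp [Cocycle.twist]
  · simp [Cocycle.twist]

lemma Cocycle.twist_twist (w w' : Γ → H) (c : X.Cocycle Γ) :
    (c.twist w).twist w' = c.twist (w' * w) := by
  ext g h
  · simp [Cocycle.twist, mul_assoc]
  · simp [Cocycle.twist, X.act_bd, mul_assoc]

lemma Cocycle.conj_twist (w : Γ → H) (γ : G) (c : X.Cocycle Γ) :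
    (c.twist w).conj γ = (c.conj γ).twist (fun g => X.act γ (w g)) := by
  ext g h
  · simp [Cocycle.twist, Cocycle.conj, mul_assoc, X.bd_act]
  · simp [Cocycle.twist, Cocycle.conj, mul_assoc]

/-- Twists and conjugations together form an action of the semidirect product of `Γ → H` by `G`,
with `conj_twist` as the commutation rule; the relation is its orbit relation. -/
lemma cohomologous_equivalence : Equivalence (Cohomologous (X := X) (Γ := Γ)) where
  refl c := (cohomologous_iff _ _).mpr ⟨1, 1, by rw [c.conj_one, c.twist_one]⟩
  symm {c d} h := by
    obtain ⟨γ, w, rfl⟩ := (cohomologous_iff _ _).mp h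
    refine (cohomologous_iff _ _).mpr ⟨γ⁻¹, fun g => X.act γ⁻¹ (w g)⁻¹, ?_⟩
    rw [Cocycle.conj_twist, Cocycle.twist_twist, Cocycle.conj_conj, inv_mul_cancel,
      Cocycle.conj_one]
    convert c.twist_one.symm using 2
    funext g
    simp
  trans {c d e} h h' := by
    obtain ⟨γ, w, rfl⟩ := (cohomologous_iff _ _).mp h
    obtain ⟨δ, w', rfl⟩ := (cohomologous_iff _ _).mp h'
    refine (cohomologous_iff _ _).mpr ⟨δ * γ, w' * fun g => X.act δ (w g), ?_⟩
    rw [Cocycle.conj_twist, Cocycle.twist_twist, Cocycle.conj_conj]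

/-- Equality in a `Quot` gives only the generated equivalence relation; here that is the relation
itself, so witnesses `γ` and `w` can be extracted. -/
lemma H1.mk_eq_iff (c d : X.Cocycle Γ) : H1.mk c = H1.mk d ↔ Cohomologous c d :=
  Quot.eq.trans (Iff.of_eq (congrFun (congrFun cohomologous_equivalence.eqvGen_eq c) d))

end Cohomology

namespace Extension

/-! ### The obstruction cocycle of a lift -/

section Basic

variable {N H₀ H₁ G : Type*} [CommGroup N] [Group H₀] [Group H₁] [Group G]
  (E : Extension N H₀ H₁ G) {Γ : Type*} [Group Γ]

lemma exists_i_eq {x : H₀} (hx : E.p x = 1) : ∃ n, E.i n = x := by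
  have : x ∈ E.i.range := E.range_i ▸ hx
  exact this

lemma exists_lift (c : E.X₁.Cocycle Γ) : ∃ v : Γ → Γ → H₀, ∀ g h, E.p (v g h) = c.u g h :=
  ⟨fun g h => (E.p_surjective (c.u g h)).choose, fun g h => (E.p_surjective (c.u g h)).choose_spec⟩

variable {E}

/-- The lift `v` need not be a cocycle, but it has the same boundary as `u`, and elements of the
form `∂(v)` act on `H₀` by conjugation. -/
lemma act_act_of_lift {c : E.X₁.Cocycle Γ} {v : Γ → Γ → H₀} (hv : ∀ g h, E.p (v g h) = c.u g h)
    (g h : Γ) (x : H₀) : E.X₀.act (c.α g) (E.X₀.act (c.α h) x) =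
      v g h * E.X₀.act (c.α (g * h)) x * (v g h)⁻¹ := by
  rw [← MulAut.mul_apply, ← map_mul, c.α_mul, ← hv, E.bd_p, map_mul, MulAut.mul_apply,
    E.X₀.act_bd]

/-- The defining identity of the obstruction cochain without inverses. -/
lemma isObsCochain_iff {α : Γ → G} {v : Γ → Γ → H₀} {ω : Γ → Γ → Γ → N} :
    E.IsObsCochain α v ω ↔ ∀ g h k, E.X₀.act (α g) (v h k) * v g (h * k) =
      E.i (ω g h k) * (v g h * v (g * h) k) := by
  refine forall_congr' fun g => forall_congr' fun h => forall_congr' fun k => ?_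
  rw [eq_comm, mul_inv_eq_iff_eq_mul, mul_inv_eq_iff_eq_mul, mul_assoc]

lemma IsObsCochain.unique {α : Γ → G} {v : Γ → Γ → H₀} {ω ω' : Γ → Γ → Γ → N}
    (h : E.IsObsCochain α v ω) (h' : E.IsObsCochain α v ω') : ω = ω' := by
  funext g₁ g₂ g₃
  exact E.i_injective ((h g₁ g₂ g₃).trans (h' g₁ g₂ g₃).symm)

/-- The cocycle identity for `u` says that `p` kills the expression, which therefore comes from `N`.
-/
lemma exists_isObsCochain {c : E.X₁.Cocycle Γ} {v : Γ → Γ → H₀}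
    (hv : ∀ g h, E.p (v g h) = c.u g h) : ∃ ω, E.IsObsCochain c.α v ω := by
  have : ∀ g h k, ∃ n, E.i n =
      E.X₀.act (c.α g) (v h k) * v g (h * k) * (v (g * h) k)⁻¹ * (v g h)⁻¹ := by
    intro g h k
    apply E.exists_i_eq
    simp only [map_mul, map_inv, E.p_act, hv]
    rw [mul_inv_eq_one, mul_inv_eq_iff_eq_mul, c.u_mul]
  choose ω hω using this
  exact ⟨ω, hω⟩

/-- The product `α_g(α_h(v_{k,l}) v_{h,kl}) v_{g,hkl}` is brought to the form (element of `N`) times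
`v_{g,h} v_{gh,k} v_{ghk,l}` in two ways; comparing the central factors gives the 3-cocycle
identity. -/
lemma IsObsCochain.mem_Z3 {c : E.X₁.Cocycle Γ} {v : Γ → Γ → H₀} {ω : Γ → Γ → Γ → N}
    (hv : ∀ g h, E.p (v g h) = c.u g h) (hω : E.IsObsCochain c.α v ω) :
    ω ∈ GrpCoh.Z3 (E.actΓ c) := by
  rw [isObsCochain_iff] at hω
  rw [MonoidHom.mem_ker]
  funext g h k l
  have cen := E.i_central
  -- First way: use the defining identity inside `α_g`; three values of `ω` appear.
  have e1 : E.X₀.act (c.α g) (E.X₀.act (c.α h) (v k l) * v h (k * l)) * v g (h * (k * l)) =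
      E.i (E.actΓ c g (ω h k l) * ω g (h * k) l * ω g h k) *
        (v g h * v (g * h) k * v (g * h * k) l) := by
    have i1 : E.X₀.act (c.α g) (E.i (ω h k l)) = E.i (E.actΓ c g (ω h k l)) :=
      (E.i_actN _ _).symm
    have h1 := hω g (h * k) l
    rw [hω, map_mul, map_mul, i1, ← mul_assoc h k l, mul_assoc, mul_assoc, h1,
      ← mul_assoc _ (E.i _), ← cen, mul_assoc, ← mul_assoc (E.X₀.act (c.α g) (v h k)), hω g h k]
    simp only [map_mul, mul_assoc]
  -- Second way: distribute `α_g` and turn `α_g α_h` into a conjugate of `α_{gh}`; the other two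
  -- values appear.
  have e2 : E.X₀.act (c.α g) (E.X₀.act (c.α h) (v k l) * v h (k * l)) * v g (h * (k * l)) =
      E.i (ω g h (k * l) * ω (g * h) k l) * (v g h * v (g * h) k * v (g * h * k) l) := by
    rw [map_mul, mul_assoc, hω g h (k * l), act_act_of_lift hv, ← mul_assoc _ (E.i _), ← cen]
    simp only [mul_assoc, inv_mul_cancel_left]
    have h1 := hω (g * h) k l
    simp only [mul_assoc] at h1
    rw [h1, ← mul_assoc (v g h), ← cen]
    simp only [map_mul, mul_assoc]
  have e := E.i_injective (mul_right_cancel (e1.symm.trans e2))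
  simp only [GrpCoh.d3, MonoidHom.coe_mk, OneHom.coe_mk, Pi.one_apply]
  rw [← mul_inv_eq_one] at e
  rw [← e]
  simp only [mul_inv, mul_assoc, mul_left_comm, mul_comm]

lemma exists_isObsClass {c : E.X₁.Cocycle Γ} {v : Γ → Γ → H₀}
    (hv : ∀ g h, E.p (v g h) = c.u g h) : ∃ x, E.IsObsClass c v x := by
  obtain ⟨ω, hω⟩ := exists_isObsCochain hv
  exact ⟨_, ⟨ω, hω.mem_Z3 hv⟩, hω, rfl⟩

/-- The values of `η` are central, so they can be collected in front, where they form `d2 η`. -/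
lemma IsObsCochain.mul_i {c : E.X₁.Cocycle Γ} {v : Γ → Γ → H₀} {ω : Γ → Γ → Γ → N}
    (hω : E.IsObsCochain c.α v ω) (η : Γ → Γ → N) :
    E.IsObsCochain c.α (fun g h => E.i (η g h) * v g h) (GrpCoh.d2 (E.actΓ c) η * ω) := by
  rw [isObsCochain_iff] at hω ⊢
  intro g h k
  have cen := E.i_central
  have i1 : E.X₀.act (c.α g) (E.i (η h k)) = E.i (E.actΓ c g (η h k)) :=
    (E.i_actN _ _).symm
  have e1 : E.X₀.act (c.α g) (E.i (η h k) * v h k) * (E.i (η g (h * k)) * v g (h * k)) =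
      E.i (E.actΓ c g (η h k) * η g (h * k) * ω g h k) * (v g h * v (g * h) k) := by
    rw [map_mul, i1, mul_assoc, ← mul_assoc _ (E.i _), ← cen, mul_assoc, hω]
    simp only [map_mul, mul_assoc]
  have e2 : E.i (η g h) * v g h * (E.i (η (g * h) k) * v (g * h) k) =
      E.i (η g h * η (g * h) k) * (v g h * v (g * h) k) := by
    rw [mul_assoc, ← mul_assoc _ (E.i _), ← cen]
    simp only [map_mul, mul_assoc]
  rw [e1, e2, ← mul_assoc (E.i ((GrpCoh.d2 (E.actΓ c) η * ω) g h k)), ← map_mul]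
  congr 2
  simp only [GrpCoh.d2, MonoidHom.coe_mk, OneHom.coe_mk, Pi.mul_apply]
  have key (a q r s w : N) : a * q * w = a * s⁻¹ * q * r⁻¹ * w * (r * s) := by
    rw [show a * s⁻¹ * q * r⁻¹ * w * (r * s) = a * q * w * (r⁻¹ * r) * (s⁻¹ * s) by ac_rfl,
      inv_mul_cancel, inv_mul_cancel, mul_one, mul_one]
  exact key _ _ _ _ _

/-- Two lifts of `u` differ by a 2-cochain `η` in `N`, hence their obstruction cochains differ by
`d2 η`. -/
lemma IsObsClass.unique {c : E.X₁.Cocycle Γ} {v v' : Γ → Γ → H₀} {x x' : GrpCoh.H3 (E.actΓ c)}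
    (hv : ∀ g h, E.p (v g h) = c.u g h) (hv' : ∀ g h, E.p (v' g h) = c.u g h)
    (hx : E.IsObsClass c v x) (hx' : E.IsObsClass c v' x') : x = x' := by
  obtain ⟨ω, hω, rfl⟩ := hx
  obtain ⟨ω', hω', rfl⟩ := hx'
  have : ∀ g h, ∃ n, E.i n = v' g h * (v g h)⁻¹ := fun g h =>
    E.exists_i_eq (by rw [map_mul, map_inv, hv, hv', mul_inv_cancel])
  choose η hη using this
  have h := hω.mul_i η
  simp only [hη, inv_mul_cancel_right] at h
  refine QuotientGroup.eq.mpr ⟨η, ?_⟩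
  change _ = ω.1⁻¹ * ω'.1
  rw [hω'.unique h, mul_comm, mul_inv_cancel_right]

/-- This is the computation behind `Cocycle.twist`, carried out upstairs with the central defect `ω`
along for the ride. -/
lemma isObsCochain_twist {c : E.X₁.Cocycle Γ} {v : Γ → Γ → H₀} {ω : Γ → Γ → Γ → N}
    (hv : ∀ g h, E.p (v g h) = c.u g h) (hω : E.IsObsCochain c.α v ω) (w : Γ → H₀) :
    E.IsObsCochain (c.twist (fun g => E.p (w g))).α
      (fun g h => w g * E.X₀.act (c.α g) (w h) * v g h * (w (g * h))⁻¹) ω := by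
  rw [isObsCochain_iff] at hω ⊢
  intro g h k
  have h1 := hω g h k
  rw [← eq_mul_inv_iff_mul_eq] at h1
  have cen : ∀ x, x * E.i (ω g h k) = E.i (ω g h k) * x := fun x => (E.i_central _ _).symm
  have cen' : ∀ x y, x * (E.i (ω g h k) * y) = E.i (ω g h k) * (x * y) := fun x y => by
    rw [← mul_assoc, cen, mul_assoc]
  simp only [Cocycle.twist, E.bd_p, map_mul, MulAut.mul_apply, E.X₀.act_bd, map_inv, h1,
    act_act_of_lift hv, mul_inv_rev, inv_inv, mul_assoc, cen', inv_mul_cancel_left]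

lemma isObsCochain_conj {c : E.X₁.Cocycle Γ} {v : Γ → Γ → H₀} {ω : Γ → Γ → Γ → N}
    (hω : E.IsObsCochain c.α v ω) (γ : G) :
    E.IsObsCochain (c.conj γ).α (fun g h => E.X₀.act γ (v g h))
      (fun g h k => E.actN γ (ω g h k)) := by
  intro g h k
  rw [E.i_actN, hω]
  simp [Cocycle.conj]

/-! ### The direct sum and its orbits -/

/-- Summands whose module structures are only propositionally equal have different types; inside the
direct sum their classes can be compared through the underlying cochains. -/
lemma of_mk_congr {a b : E.ModStr Γ} (hab : a.1 = b.1) (ω : GrpCoh.Z3 a.1) (ω' : GrpCoh.Z3 b.1)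
    (h : ω.1 = ω'.1) :
    DirectSum.of (fun a : E.ModStr Γ => Additive (GrpCoh.H3 a.1)) a
        (Additive.ofMul (QuotientGroup.mk ω)) =
      DirectSum.of (fun a : E.ModStr Γ => Additive (GrpCoh.H3 a.1)) b
        (Additive.ofMul (QuotientGroup.mk ω')) := by
  obtain rfl : a = b := Subtype.ext hab
  obtain rfl : ω = ω' := Subtype.ext h
  rfl

lemma sumAct_of_mk (γ : G) (a : E.ModStr Γ) (ω : GrpCoh.Z3 a.1) :
    E.sumAct Γ γ (DirectSum.of (fun a : E.ModStr Γ => Additive (GrpCoh.H3 a.1)) a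
        (Additive.ofMul (QuotientGroup.mk ω))) =
      DirectSum.of (fun a : E.ModStr Γ => Additive (GrpCoh.H3 a.1)) (E.conjModStr γ a)
        (Additive.ofMul (E.conjH3 γ a (QuotientGroup.mk ω))) := by
  simp [sumAct]

/-- Additive maps on the direct sum that agree on classes of cocycles are equal. -/
lemma H3Sum_hom_ext {M : Type*} [AddCommMonoid M] {S T : E.H3Sum Γ →+ M}
    (h : ∀ (a : E.ModStr Γ) (ω : GrpCoh.Z3 a.1),
      S (DirectSum.of (fun a : E.ModStr Γ => Additive (GrpCoh.H3 a.1)) a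
        (Additive.ofMul (QuotientGroup.mk ω))) =
      T (DirectSum.of (fun a : E.ModStr Γ => Additive (GrpCoh.H3 a.1)) a
        (Additive.ofMul (QuotientGroup.mk ω)))) : S = T := by
  refine DirectSum.addHom_ext fun a x => ?_
  induction x using Additive.rec with
  | ofMul x =>
    induction x using QuotientGroup.induction_on with
    | H ω => exact h a ω

lemma sumAct_inv_sumAct (γ : G) (x : E.H3Sum Γ) : E.sumAct Γ γ⁻¹ (E.sumAct Γ γ x) = x := by
  suffices (E.sumAct Γ γ⁻¹).comp (E.sumAct Γ γ) = AddMonoidHom.id _ from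
    DFunLike.congr_fun this x
  refine H3Sum_hom_ext fun a ω => ?_
  rw [AddMonoidHom.comp_apply, sumAct_of_mk]
  refine (sumAct_of_mk γ⁻¹ _ _).trans (of_mk_congr ?_ _ _ ?_)
  · ext g n
    simp [conjModStr]
  · funext g h k
    simp [GrpCoh.Z3map]

/-- Each `γ` acts by an injective additive map, so being zero is invariant under the action. -/
lemma obs_mk_eq_base_iff (x : E.H3Sum Γ) : Obs.mk E x = Obs.base E Γ ↔ x = 0 := by
  refine ⟨fun h => ?_, fun h => by rw [h]; rfl⟩
  -- Descending the predicate "is zero" to the quotient avoids analysing the equivalence relation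
  -- generated by the action.
  let P : E.Obs Γ → Prop := Quot.lift (fun x => x = 0) (by
    rintro x _ ⟨γ, rfl⟩
    refine propext ⟨fun h => by rw [h, map_zero], fun h => ?_⟩
    rw [← sumAct_inv_sumAct γ x, h, map_zero])
  have h1 : P (Obs.base E Γ) := rfl
  rw [← h] at h1
  exact h1

lemma ι_eq_base_iff (c : E.X₁.Cocycle Γ) (x : GrpCoh.H3 (E.actΓ c)) :
    E.ι c x = Obs.base E Γ ↔ x = 1 := by
  rw [ι, obs_mk_eq_base_iff, toSum]
  exact (map_eq_zero_iff _ (DirectSum.of_injective _)).trans Iff.rfl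

/-! ### The connecting map is well defined -/

lemma actΓ_twist (c : E.X₁.Cocycle Γ) (w : Γ → H₁) : E.actΓ (c.twist w) = E.actΓ c := by
  ext g n
  simp [actΓ, Cocycle.twist, E.actN_bd]

lemma actΓ_conj (c : E.X₁.Cocycle Γ) (γ : G) :
    E.actΓ (c.conj γ) = (E.conjModStr γ (E.modStr c)).1 := by
  ext g n
  simp [actΓ, Cocycle.conj, conjModStr, modStr, MulAut.conj_apply]

lemma IsObsClass.ι_twist {c : E.X₁.Cocycle Γ} {v v' : Γ → Γ → H₀} {w : Γ → H₁}
    {x : GrpCoh.H3 (E.actΓ c)} {x' : GrpCoh.H3 (E.actΓ (c.twist w))}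
    (hv : ∀ g h, E.p (v g h) = c.u g h) (hv' : ∀ g h, E.p (v' g h) = (c.twist w).u g h)
    (hx : E.IsObsClass c v x) (hx' : E.IsObsClass (c.twist w) v' x') :
    E.ι (c.twist w) x' = E.ι c x := by
  obtain ⟨w, rfl⟩ : ∃ w' : Γ → H₀, w = fun g => E.p (w' g) :=
    ⟨fun g => (E.p_surjective (w g)).choose,
      funext fun g => (E.p_surjective (w g)).choose_spec.symm⟩
  obtain ⟨ω, hω, rfl⟩ := hx
  have hω' := isObsCochain_twist hv hω w
  have hv₁ : ∀ g h, E.p (w g * E.X₀.act (c.α g) (w h) * v g h * (w (g * h))⁻¹) =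
      (c.twist (fun g => E.p (w g))).u g h := fun g h => by
    simp [Cocycle.twist, E.p_act, hv]
  -- The class does not depend on the lift, so `v'` may be replaced by the twist of `v`, whose
  -- cochain is again `ω`. Both classes then agree already in the direct sum.
  rw [hx'.unique hv' hv₁ ⟨⟨_, hω'.mem_Z3 hv₁⟩, hω', rfl⟩]
  exact congrArg (Obs.mk E) (of_mk_congr (actΓ_twist c _) _ _ rfl)

lemma IsObsClass.ι_conj {c : E.X₁.Cocycle Γ} {v v' : Γ → Γ → H₀} {γ : G}
    {x : GrpCoh.H3 (E.actΓ c)} {x' : GrpCoh.H3 (E.actΓ (c.conj γ))}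
    (hv : ∀ g h, E.p (v g h) = c.u g h) (hv' : ∀ g h, E.p (v' g h) = (c.conj γ).u g h)
    (hx : E.IsObsClass c v x) (hx' : E.IsObsClass (c.conj γ) v' x') :
    E.ι (c.conj γ) x' = E.ι c x := by
  obtain ⟨ω, hω, rfl⟩ := hx
  have hω' := isObsCochain_conj hω γ
  have hv₁ : ∀ g h, E.p (E.X₀.act γ (v g h)) = (c.conj γ).u g h := fun g h => by
    simp [Cocycle.conj, E.p_act, hv]
  rw [hx'.unique hv' hv₁ ⟨⟨_, hω'.mem_Z3 hv₁⟩, hω', rfl⟩]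
  -- Unlike for a twist, the summand may change; only the orbits agree.
  refine (Quot.sound ⟨γ, ?_⟩ : E.ι c _ = E.ι (c.conj γ) _).symm
  refine Eq.trans ?_ (sumAct_of_mk γ (E.modStr c) ω).symm
  exact of_mk_congr (actΓ_conj c γ) _ _ rfl

lemma IsObsClass.ι_eq_of_cohomologous {c d : E.X₁.Cocycle Γ} {v v' : Γ → Γ → H₀}
    {x : GrpCoh.H3 (E.actΓ c)} {x' : GrpCoh.H3 (E.actΓ d)}
    (hv : ∀ g h, E.p (v g h) = c.u g h) (hv' : ∀ g h, E.p (v' g h) = d.u g h)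
    (hx : E.IsObsClass c v x) (hx' : E.IsObsClass d v' x') (hcd : Cohomologous c d) :
    E.ι c x = E.ι d x' := by
  obtain ⟨γ, w, rfl⟩ := (cohomologous_iff _ _).mp hcd
  obtain ⟨v₁, hv₁⟩ := E.exists_lift (c.conj γ)
  obtain ⟨x₁, hx₁⟩ := exists_isObsClass hv₁
  rw [hx₁.ι_twist hv₁ hv' hx', hx.ι_conj hv hv₁ hx₁]

variable (E Γ) in
lemma exists_isConnecting : ∃ θ : E.X₁.H1 Γ → E.Obs Γ, E.IsConnecting θ := by
  choose v hv using fun c : E.X₁.Cocycle Γ => E.exists_lift c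
  choose x hx using fun c : E.X₁.Cocycle Γ => exists_isObsClass (hv c)
  refine ⟨Quot.lift (fun c => E.ι c (x c)) fun c d h =>
    (hx c).ι_eq_of_cohomologous (hv c) (hv d) (hx d) h, fun c v' hv' => ?_⟩
  obtain ⟨x', hx'⟩ := exists_isObsClass hv'
  refine ⟨x', hx', ?_⟩
  rw [hx'.unique hv' (hv c) (hx c)]
  rfl

/-- `IsConnecting` provides some obstruction class for `v`; by uniqueness every obstruction class
computes `θ`. -/
lemma IsConnecting.apply_eq {θ : E.X₁.H1 Γ → E.Obs Γ} (hθ : E.IsConnecting θ)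
    {c : E.X₁.Cocycle Γ} {v : Γ → Γ → H₀} {x : GrpCoh.H3 (E.actΓ c)}
    (hv : ∀ g h, E.p (v g h) = c.u g h) (hx : E.IsObsClass c v x) :
    θ (H1.mk c) = E.ι c x := by
  obtain ⟨x', hx', h⟩ := hθ c v hv
  rw [h, hx.unique hv hv hx']

/-! ### Exactness at the two middle terms, and kernels -/

variable (E Γ) in
lemma pointedExact_fromH2 :
    PointedExact (E.fromH2 Γ) (H1.map E.proj (MonoidHom.id Γ)) (H1.base E.X₁ Γ) := by
  intro y
  constructor
  · obtain ⟨c, rfl⟩ := Quot.exists_rep y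
    intro h
    have h' := (cohomologous_iff _ _).mp ((H1.mk_eq_iff _ _).mp h.symm)
    obtain ⟨γ, w, hw⟩ := h'
    obtain ⟨w, rfl⟩ : ∃ w' : Γ → H₀, w = fun g => E.p (w' g) :=
      ⟨fun g => (E.p_surjective (w g)).choose,
        funext fun g => (E.p_surjective (w g)).choose_spec.symm⟩
    -- The element `γ` drops out because conjugation fixes the trivial cocycle.
    have hα : ∀ g, c.α g = E.X₀.bd (w g) := fun g => by
      have := congrFun (congrArg Cocycle.α hw) g
      simpa [Cocycle.map, proj, Cocycle.twist, Cocycle.conj, Cocycle.triv, E.bd_p] using this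
    have hu : ∀ g h, E.p (c.u g h) = E.p (w g) * E.p (w h) * (E.p (w (g * h)))⁻¹ := fun g h => by
      have := congrFun (congrFun (congrArg Cocycle.u hw) g) h
      simpa [Cocycle.map, proj, Cocycle.twist, Cocycle.conj, Cocycle.triv] using this
    -- Undoing the twist upstairs makes the first component trivial and moves the second into the
    -- kernel of `p`, that is, into `N`.
    have h1 : ∀ g, (c.twist w⁻¹).α g = 1 := fun g => by
      simp [Cocycle.twist, hα]
    have h2 : ∀ g h, ∃ n, E.i n = (c.twist w⁻¹).u g h := fun g h => by
      apply E.exists_i_eq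
      simp [Cocycle.twist, hα, E.X₀.act_bd, hu, mul_assoc]
    choose l hl using h2
    refine ⟨QuotientGroup.mk ⟨l, ?_⟩, ?_⟩
    · rw [MonoidHom.mem_ker]
      funext g h k
      have h3 := (c.twist w⁻¹).u_mul g h k
      rw [h1, map_one, MulAut.one_apply, ← hl, ← hl, ← hl, ← hl, ← map_mul, ← map_mul] at h3
      have h4 := E.i_injective h3
      simp only [GrpCoh.d2, MonoidHom.coe_mk, OneHom.coe_mk, Pi.one_apply, MonoidHom.one_apply,
        MulAut.one_apply]
      rw [mul_inv_eq_one, mul_right_comm, mul_inv_eq_iff_eq_mul, h4]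
    · refine ((H1.mk_eq_iff _ _).mpr (cohomologous_equivalence.symm
        ((cohomologous_iff _ _).mpr ⟨1, w⁻¹, ?_⟩)) : H1.mk (E.cocycleOfZ2 _) = H1.mk c)
      rw [Cocycle.conj_one]
      ext g h
      · exact (h1 g).symm
      · exact hl g h
  · rintro ⟨x, rfl⟩
    induction x using QuotientGroup.induction_on with
    | H l =>
      refine congrArg H1.mk (?_ : Cocycle.map _ _ (E.cocycleOfZ2 l) = _)
      ext g h
      · rfl
      · exact E.p_i _

lemma IsConnecting.pointedExact {θ : E.X₁.H1 Γ → E.Obs Γ} (hθ : E.IsConnecting θ) :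
    PointedExact (H1.map E.proj (MonoidHom.id Γ)) θ (Obs.base E Γ) := by
  intro y
  constructor
  · obtain ⟨c, rfl⟩ := Quot.exists_rep y
    intro h
    obtain ⟨v, hv⟩ := E.exists_lift c
    obtain ⟨x, ⟨ω, hω, rfl⟩, h1⟩ := hθ c v hv
    have h2 := (ι_eq_base_iff _ _).mp (h1.symm.trans h)
    rw [QuotientGroup.eq_one_iff] at h2
    obtain ⟨η, hη⟩ := h2
    -- Since `ω = d2 η`, the corrected lift `η⁻¹ v` has trivial obstruction cochain, which is the
    -- cocycle identity in `H₀`.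
    have h3 := hω.mul_i η⁻¹
    have h4 : GrpCoh.d2 (E.actΓ c) η = ω.1 := hη
    rw [map_inv, h4, inv_mul_cancel, isObsCochain_iff] at h3
    have h5 : ∀ g h, E.p (E.i (η⁻¹ g h) * v g h) = c.u g h := fun g h => by
      rw [map_mul, E.p_i, one_mul, hv]
    refine ⟨H1.mk ⟨c.α, fun g h => E.i (η⁻¹ g h) * v g h, fun g h => ?_, fun g h k => ?_⟩, ?_⟩
    · rw [← E.bd_p, h5, c.α_mul]
    · simpa using h3 g h k
    · refine congrArg H1.mk ?_
      ext g h
      · rfl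
      · exact h5 g h
  · rintro ⟨x, rfl⟩
    obtain ⟨c, rfl⟩ := Quot.exists_rep x
    -- For a cocycle coming from `H₀`, its own second component is a lift with `ω = 1`.
    have hc : E.IsObsCochain (c.map E.proj (MonoidHom.id Γ)).α c.u 1 := by
      rw [isObsCochain_iff]
      intro g h k
      simpa [Cocycle.map, proj] using c.u_mul g h k
    refine (hθ.apply_eq (fun _ _ => rfl) ⟨1, hc, rfl⟩).trans ?_
    exact (ι_eq_base_iff _ _).mpr rfl

lemma IsConnecting.isExactSequence {θ : E.X₁.H1 Γ → E.Obs Γ} (hθ : E.IsConnecting θ) :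
    E.IsExactSequence θ := by
  have hp : H1.map E.proj (MonoidHom.id Γ) (H1.base E.X₀ Γ) = H1.base E.X₁ Γ := by
    refine congrArg H1.mk ?_
    ext g h
    · rfl
    · exact map_one E.p
  refine ⟨hθ, ?_, hp, (hθ.pointedExact _).mpr ⟨_, hp⟩, E.pointedExact_fromH2 Γ, hθ.pointedExact⟩
  refine congrArg H1.mk ?_
  ext g h
  · rfl
  · exact map_one E.i

lemma IsConnecting.isKernelObstruction {θ : E.X₁.H1 Γ → E.Obs Γ} (hθ : E.IsConnecting θ)
    (hbd : Function.Injective E.X₁.bd) {Q : Type*} [Group Q] (q : G →* Q) :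
    E.IsKernelObstruction q θ := by
  intro _ α v _ h
  have hα : ∀ g h, α g * α h = E.X₁.bd (E.p (v g h)) * α (g * h) := fun g₁ g₂ => by
    rw [E.bd_p, h]
  refine ⟨⟨α, fun g h => E.p (v g h), hα, fun g h k => hbd ?_⟩, rfl, fun _ _ => rfl,
    hθ _ v fun _ _ => rfl⟩
  -- After applying the injective boundary, both sides of the cocycle identity become `α_g α_h α_k
  -- α_{ghk}⁻¹`.
  have h1 : ∀ g h, E.X₁.bd (E.p (v g h)) = α g * α h * (α (g * h))⁻¹ := fun g h =>
    eq_mul_inv_of_mul_eq (hα g h).symm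
  simp only [map_mul, E.X₁.bd_act, h1, mul_assoc g h k]
  group

end Basic

/-! ### Naturality -/

section Naturality

variable {N H₀ H₁ G N' H₀' H₁' G' : Type*} [CommGroup N] [Group H₀] [Group H₁] [Group G]
  [CommGroup N'] [Group H₀'] [Group H₁'] [Group G']
  {E : Extension N H₀ H₁ G} {E' : Extension N' H₀' H₁' G'}
  {Γ Γ' : Type*} [Group Γ] [Group Γ']

lemma IsConnecting.naturalSquares {θ' : E'.X₁.H1 Γ' → E'.Obs Γ'} (hθ' : E'.IsConnecting θ')
    (Φ : Hom E E') (f : Γ' →* Γ) : NaturalSquares Φ f θ' where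
  square₀ x := by
    induction x using QuotientGroup.induction_on with
    | H l =>
      refine congrArg H1.mk (?_ : E'.cocycleOfZ2 _ = Cocycle.map Φ.f₀ f (E.cocycleOfZ2 l))
      ext g h
      · exact (map_one Φ.f₀.base).symm
      · exact Φ.comm_i _
  square₁ y := by
    obtain ⟨c, rfl⟩ := Quot.exists_rep y
    refine congrArg H1.mk ?_
    ext g h
    · exact DFunLike.congr_fun Φ.base_eq _
    · exact Φ.comm_p _
  class₂ c v x hv := by
    rintro ⟨ω, hω, rfl⟩
    have h1 : E'.IsObsClass (c.map Φ.f₁ f) (fun g h => Φ.f₀.top (v (f g) (f h)))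
        (Φ.H3map f c (QuotientGroup.mk ω)) := by
      refine ⟨GrpCoh.Z3map f Φ.fN (fun g n => Φ.fN_actN (c.α (f g)) n) ω, fun g h k => ?_, rfl⟩
      refine (Φ.comm_i _).trans ?_
      rw [hω]
      simp [Φ.f₀.top_act, Cocycle.map, Φ.base_eq]
    exact ⟨h1, hθ'.apply_eq (fun g h => by rw [Φ.comm_p, hv]; rfl) h1⟩

/-- The homomorphism of direct sums induced by a morphism of extensions; on the summand of a
module structure it is computed with a chosen cocycle inducing that structure. -/
def Hom.sumMap (Φ : Hom E E') (f : Γ' →* Γ) : E.H3Sum Γ →+ E'.H3Sum Γ' :=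
  DirectSum.toAddMonoid fun a =>
    (DirectSum.of (fun a : E'.ModStr Γ' => Additive (GrpCoh.H3 a.1))
      (E'.modStr (a.2.choose.map Φ.f₁ f))).comp
      (MonoidHom.toAdditive (GrpCoh.H3map f Φ.fN (fun g n =>
        (congrArg (fun ρ : Γ →* MulAut N => Φ.fN (ρ (f g) n)) a.2.choose_spec).trans
          (Φ.fN_actN (a.2.choose.α (f g)) n))))

/-- `RespectsModStr` makes the target summand independent of the cocycle chosen in `sumMap`, so it
may be replaced by `c`. -/
lemma Hom.sumMap_toSum {Φ : Hom E E'} {f : Γ' →* Γ} (hΦ : Φ.RespectsModStr f)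
    (c : E.X₁.Cocycle Γ) (x : GrpCoh.H3 (E.actΓ c)) :
    Φ.sumMap f (E.toSum c x) = E'.toSum (c.map Φ.f₁ f) (Φ.H3map f c x) := by
  induction x using QuotientGroup.induction_on with
  | H ω =>
    refine (DirectSum.toAddMonoid_of _ _ _).trans (of_mk_congr ?_ _ _ rfl)
    exact hΦ _ _ (E.modStr c).2.choose_spec.symm

lemma Hom.sumMap_sumAct {Φ : Hom E E'} {f : Γ' →* Γ} (hΦ : Φ.RespectsModStr f) (γ : G)
    (y : E.H3Sum Γ) :
    Φ.sumMap f (E.sumAct Γ γ y) = E'.sumAct Γ' (Φ.f₁.base γ) (Φ.sumMap f y) := by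
  suffices (Φ.sumMap f).comp (E.sumAct Γ γ) =
      (E'.sumAct Γ' (Φ.f₁.base γ)).comp (Φ.sumMap f) from DFunLike.congr_fun this y
  refine H3Sum_hom_ext fun a ω => ?_
  obtain ⟨_, c, rfl⟩ := a
  have hconj : (GrpCoh.Z3 (E.conjModStr γ (E.modStr c)).1) = GrpCoh.Z3 (E.actΓ (c.conj γ)) := by
    rw [actΓ_conj]
  let ω₁ : GrpCoh.Z3 (E.actΓ (c.conj γ)) :=
    ⟨fun g h k => E.actN γ (ω.1 g h k), hconj ▸ (GrpCoh.Z3map (MonoidHom.id Γ)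
      (E.actN γ).toMonoidHom (fun g m => by simp [conjModStr, modStr, MulAut.conj_apply]) ω).2⟩
  -- The translate by `γ` is expressed through the cocycle `c.conj γ`, so that `sumMap_toSum`
  -- applies to both sides; it remains to use that the image of `c.conj γ` is the conjugate of the
  -- image of `c`.
  have e1 : E.sumAct Γ γ (E.toSum c (QuotientGroup.mk ω)) =
      E.toSum (c.conj γ) (QuotientGroup.mk ω₁) :=
    (sumAct_of_mk γ (E.modStr c) ω).trans (of_mk_congr (actΓ_conj c γ).symm _ _ rfl)
  change Φ.sumMap f (E.sumAct Γ γ (E.toSum c (QuotientGroup.mk ω))) =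
    E'.sumAct Γ' (Φ.f₁.base γ) (Φ.sumMap f (E.toSum c (QuotientGroup.mk ω)))
  rw [e1, sumMap_toSum hΦ, sumMap_toSum hΦ]
  refine Eq.trans ?_ (sumAct_of_mk _ _ (GrpCoh.Z3map f Φ.fN
    (fun g n => Φ.fN_actN (c.α (f g)) n) ω)).symm
  refine of_mk_congr ?_ _ _ ?_
  · refine Eq.trans ?_ (actΓ_conj (c.map Φ.f₁ f) (Φ.f₁.base γ))
    refine congrArg (E'.actΓ) ?_
    ext g h
    · simp [Cocycle.map, Cocycle.conj]
    · simp [Cocycle.map, Cocycle.conj, Φ.f₁.top_act]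
  · funext g h k
    exact Φ.fN_actN γ _

lemma IsConnecting.naturalLastSquare {θ : E.X₁.H1 Γ → E.Obs Γ} {θ' : E'.X₁.H1 Γ' → E'.Obs Γ'}
    (hθ : E.IsConnecting θ) (hθ' : E'.IsConnecting θ') {Φ : Hom E E'} {f : Γ' →* Γ}
    (hΦ : Φ.RespectsModStr f) : NaturalLastSquare Φ f θ θ' := by
  refine ⟨Φ.sumMap f, Quot.lift (fun y => Obs.mk E' (Φ.sumMap f y)) ?_,
    Hom.sumMap_toSum hΦ, fun _ => rfl, fun z => ?_⟩
  · rintro y _ ⟨γ, rfl⟩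
    exact Quot.sound ⟨_, Hom.sumMap_sumAct hΦ γ y⟩
  · obtain ⟨c, rfl⟩ := Quot.exists_rep z
    obtain ⟨v, hv⟩ := E.exists_lift c
    obtain ⟨x, hx, h⟩ := hθ c v hv
    have h2 := ((hθ'.naturalSquares Φ f).class₂ c v x hv hx).2
    change _ = θ' (H1.map Φ.f₁ f (H1.mk c))
    rw [h2]
    change Quot.lift _ _ (θ (H1.mk c)) = _
    rw [h]
    exact congrArg (Obs.mk E') (Hom.sumMap_toSum hΦ c x)

variable (E) in
-- For fixed coefficients the new module structure is the old one composed with `f`; hence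
-- naturality in the group needs no extra condition.
lemma Hom.respectsModStr_id (f : Γ' →* Γ) : (Hom.id E).RespectsModStr f := by
  intro c d h
  exact congrArg (fun a : Γ →* MulAut N => a.comp f) h

end Naturality

end Extension

end CrossedModule

/-! ### The C*-algebraic input -/

namespace CStarCM

variable (A : Type u) [CStarAlgebra A]

/-- A unitary whose inner automorphism is trivial commutes with all unitaries, hence is trivial in
`PU(A)`. -/
lemma AdPU_injective : Function.Injective (AdPU A) := by
  rw [injective_iff_map_eq_one]
  intro x
  induction x using QuotientGroup.induction_on with
  | H x =>
    intro hx
    rw [QuotientGroup.eq_one_iff, Subgroup.mem_center_iff]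
    intro g
    have h1 : Ad A x = 1 := hx
    have h2 := (GA A).act_bd x g
    have h3 : (GA A).bd x = 1 := h1
    rw [h3, map_one, MulAut.one_apply, eq_mul_inv_iff_mul_eq] at h2
    exact h2

lemma PGAtau_bd_injective {A : Type u} [CStarAlgebra A] {τ : A →ₗ[ℂ] ℂ} (hτ : IsTracialState τ) :
    Function.Injective (PGAtau hτ).bd :=
  fun _ _ h => AdPU_injective A (congrArg Subtype.val h)

end CStarCM

end

theorem mainTheorem1 (A : Type u) [CStarAlgebra A] (Γ : Type v) [Group Γ] :
    -- `H²(Γ, Z_A) → H¹(Γ, U(A) → Aut A) → H¹(Γ, PU(A) → Aut A) → ⨁ H³(Γ, Z_A)`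
    (∃ ob : (CStarCM.PGA A).H1 Γ → (CStarCM.extU A).Obs Γ,
      (CStarCM.extU A).IsExactSequence ob ∧
      (CStarCM.extU A).IsKernelObstruction (QuotientGroup.mk' (CStarCM.Inn A)) ob) ∧
    (∀ _ : ConnectedSpace (unitary A),
      -- `H²(Γ, K₀^#) → H¹(Γ, Ũ(A) → Aut A) → H¹(Γ, PU(A) → Aut A) → ⨁ H³(Γ, K₀^#)`
      (∃ obt : (CStarCM.PGA A).H1 Γ → (CStarCM.extUtildePU A).Obs Γ,
        (CStarCM.extUtildePU A).IsExactSequence obt ∧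
        (CStarCM.extUtildePU A).IsKernelObstruction (QuotientGroup.mk' (CStarCM.Inn A)) obt) ∧
      -- `H²(Γ, π₁) → H¹(Γ, Ũ(A) → Aut A) → H¹(Γ, U(A) → Aut A) → ⨁ H³(Γ, π₁)`
      (∃ κ₃ : (CStarCM.GA A).H1 Γ → (CStarCM.extUtildeU A).Obs Γ,
        (CStarCM.extUtildeU A).IsExactSequence κ₃) ∧
      -- `H²(Γ, Z_A^τ) → H¹(Γ, SU_τ(A) → Aut_τ A) → H¹(Γ, PU(A) → Aut_τ A) → ⨁ H³(Γ, Z_A^τ)`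
      (∀ (τ : A →ₗ[ℂ] ℂ) (hτ : CStarCM.IsTracialState τ),
        ∃ obτ : (CStarCM.PGAtau hτ).H1 Γ → (CStarCM.extSU hτ).Obs Γ,
          (CStarCM.extSU hτ).IsExactSequence obτ ∧
          (CStarCM.extSU hτ).IsKernelObstruction (CStarCM.outTau τ) obτ)) ∧
    -- naturality in the group
    (∀ (N H₀ H₁ G : Type u) [CommGroup N] [Group H₀] [Group H₁] [Group G]
      (E : CrossedModule.Extension N H₀ H₁ G) (Γ₁ Γ₂ : Type v) [Group Γ₁] [Group Γ₂] (f : Γ₂ →* Γ₁)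
      (θ₁ : E.X₁.H1 Γ₁ → E.Obs Γ₁) (θ₂ : E.X₁.H1 Γ₂ → E.Obs Γ₂),
      E.IsConnecting θ₁ → E.IsConnecting θ₂ →
        CrossedModule.Extension.NaturalSquares (CrossedModule.Extension.Hom.id E) f θ₂ ∧
        CrossedModule.Extension.NaturalLastSquare (CrossedModule.Extension.Hom.id E) f θ₁ θ₂) ∧
    -- naturality in the coefficients
    (∀ (N H₀ H₁ G N' H₀' H₁' G' : Type u) [CommGroup N] [Group H₀] [Group H₁] [Group G]
      [CommGroup N'] [Group H₀'] [Group H₁'] [Group G']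
      (E : CrossedModule.Extension N H₀ H₁ G) (E' : CrossedModule.Extension N' H₀' H₁' G') (Φ : CrossedModule.Extension.Hom E E')
      (Γ₁ Γ₂ : Type v) [Group Γ₁] [Group Γ₂] (f : Γ₂ →* Γ₁)
      (θ : E.X₁.H1 Γ₁ → E.Obs Γ₁) (θ' : E'.X₁.H1 Γ₂ → E'.Obs Γ₂),
      E.IsConnecting θ → E'.IsConnecting θ' →
        CrossedModule.Extension.NaturalSquares Φ f θ' ∧
        (Φ.RespectsModStr f → CrossedModule.Extension.NaturalLastSquare Φ f θ θ')) := by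
  refine ⟨?_, fun _ => ⟨?_, ?_, fun τ hτ => ?_⟩, ?_, ?_⟩
  · obtain ⟨θ, hθ⟩ := (CStarCM.extU A).exists_isConnecting Γ
    exact ⟨θ, hθ.isExactSequence, hθ.isKernelObstruction (CStarCM.AdPU_injective A) _⟩
  · obtain ⟨θ, hθ⟩ := (CStarCM.extUtildePU A).exists_isConnecting Γ
    exact ⟨θ, hθ.isExactSequence, hθ.isKernelObstruction (CStarCM.AdPU_injective A) _⟩
  · obtain ⟨θ, hθ⟩ := (CStarCM.extUtildeU A).exists_isConnecting Γ
    exact ⟨θ, hθ.isExactSequence⟩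
  · obtain ⟨θ, hθ⟩ := (CStarCM.extSU hτ).exists_isConnecting Γ
    exact ⟨θ, hθ.isExactSequence, hθ.isKernelObstruction (CStarCM.PGAtau_bd_injective hτ) _⟩
  · intro N H₀ H₁ G _ _ _ _ E Γ₁ Γ₂ _ _ f θ₁ θ₂ h₁ h₂
    exact ⟨h₂.naturalSquares _ f,
      h₁.naturalLastSquare h₂ (CrossedModule.Extension.Hom.respectsModStr_id E f)⟩
  · intro N H₀ H₁ G N' H₀' H₁' G' _ _ _ _ _ _ _ _ E E' Φ Γ₁ Γ₂ _ _ f θ θ' h h'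
    exact ⟨h'.naturalSquares Φ f, h.naturalLastSquare h'⟩
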